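/- Let $A$, $B$ be self-adjoint operators on a complex separable infinite-dimensional Hilbert space $H$ such that 1. $D(AB)\cap D(BA)$ is dense and $[A,B]=AB-BA$ is bounded on it; 2. $D(A)\cap D(B)$ is dense and, with $C$ the closure of $A-iB$ and $\Delta=1+C^*C$ (formally $1+(A+iB)(A-iB)$), the operator $\Delta^{-1}$ is compact. On $H\oplus H$ consider the bounded operator $$Q(A,B)=\begin{pmatrix}\Delta^{-1}& C\Delta^{-1}\\ \Delta^{-1}C^*&1-\Delta^{-1}\end{pmatrix},$$ where $\Delta^{-1}C^*$ stands for its bounded extension $(C\Delta^{-1})^*$. For an orthonormal basis $(e_i)_{i\ge 0}$ of $H$ let $L_N=\operatorname{span}(e_0,\dots,e_{N-1})$ and let $q_{11}=q_{11}(N)$ be the compression of $Q(A,B)$ to $L_N\oplus L_N$. For an integer $k$, say that the small-commutator invariant of $(A,B)$ is $k$ if $\|Q^2-Q\|<\tfrac14$ and, for every orthonormal basis $(e_i)_{i\ge0}$ and all sufficiently large $N$ (depending on the basis), $\|q_{11}^2-q_{11}\|<\tfrac14$ and $M_N-N=k$, where $M_N$ is the number of eigenvalues of $q_{11}$, counted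 with multiplicity, that are greater than $\tfrac12$. Write $\omega(A,B)=k$ if there is $\delta>0$ such that for all $\lambda,\mu>0$ with $\|[\lambda A,\mu B]\|\le\delta$ the small-commutator invariant of $(\lambda A,\mu B)$ is $k$; such a $k$ is unique if it exists. **Theorem.** On $H=L^2(\mathbb R)$ let $A=x$ be multiplication by the variable on $D(A)=\{f\in L^2(\mathbb R): xf\in L^2(\mathbb R)\}$, and let $B=-i\,\frac{d}{dx}$, with the weak derivative, on $D(B)=\{f\in L^2(\mathbb R): f'\in L^2(\mathbb R)\}$. Then $A$ and $B$ are self-adjoint, the pair satisfies 1 and 2, and $$\omega(A,B)=1 .$$ -/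

import Mathlib

open MeasureTheory Filter
open scoped InnerProductSpace LinearPMap

noncomputable section

namespace Bott

section Abstract

variable {H : Type*} [NormedAddCommGroup H] [InnerProductSpace ℂ H]

/-- The composition `S T` of unbounded operators on its natural domain
`{x ∈ D(T) | T x ∈ D(S)}`. -/
def pcomp (S T : H →ₗ.[ℂ] H) : H →ₗ.[ℂ] H where
  domain :=
    { carrier := {x | ∃ hx : x ∈ T.domain, T ⟨x, hx⟩ ∈ S.domain}
      zero_mem' := ⟨T.domain.zero_mem, by
        have h : T ⟨0, T.domain.zero_mem⟩ = 0 := T.map_zero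
        rw [h]; exact S.domain.zero_mem⟩
      add_mem' := by
        rintro x y ⟨hx, hx'⟩ ⟨hy, hy'⟩
        refine ⟨T.domain.add_mem hx hy, ?_⟩
        have h : T ⟨x + y, T.domain.add_mem hx hy⟩ = T ⟨x, hx⟩ + T ⟨y, hy⟩ :=
          T.map_add ⟨x, hx⟩ ⟨y, hy⟩
        rw [h]; exact S.domain.add_mem hx' hy'
      smul_mem' := by
        rintro c x ⟨hx, hx'⟩
        refine ⟨T.domain.smul_mem c hx, ?_⟩
        have h : T ⟨c • x, T.domain.smul_mem c hx⟩ = c • T ⟨x, hx⟩ := T.map_smul c ⟨x, hx⟩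
        rw [h]; exact S.domain.smul_mem c hx' }
  toFun :=
    { toFun := fun x => S ⟨T ⟨x, x.2.1⟩, x.2.2⟩
      map_add' := fun x y => by
        rw [← S.map_add]
        congr 1
        exact Subtype.ext (T.map_add ⟨x, x.2.1⟩ ⟨y, y.2.1⟩)
      map_smul' := fun c x => by
        rw [RingHom.id_apply, ← S.map_smul]
        congr 1
        exact Subtype.ext (T.map_smul c ⟨x, x.2.1⟩) }

/-- The commutator `AB - BA`, with domain `D(AB) ∩ D(BA)`. -/
def commutator (A B : H →ₗ.[ℂ] H) : H →ₗ.[ℂ] H := pcomp A B - pcomp B A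

/-- `‖[A,B]‖ ≤ c`. -/
def CommutatorBound (A B : H →ₗ.[ℂ] H) (c : ℝ) : Prop :=
  ∀ x : (commutator A B).domain, ‖commutator A B x‖ ≤ c * ‖(x : H)‖

theorem CommutatorBound.smul {A B : H →ₗ.[ℂ] H} {c δ : ℝ} (h : CommutatorBound A B c) {s : ℝ}
    (hs : 0 < s) (hδ : s * c ≤ δ) : CommutatorBound ((s : ℂ) • A) B δ := by
  rintro ⟨x, ⟨hB, hAB⟩, hA, hBA⟩
  have hs0 : (s : ℂ) ≠ 0 := by exact_mod_cast hs.ne'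
  have hBA' : A ⟨x, hA⟩ ∈ B.domain := by
    have h1 : (s : ℂ) • A ⟨x, hA⟩ ∈ B.domain := hBA
    have h2 := B.domain.smul_mem (s : ℂ)⁻¹ h1
    rwa [smul_smul, inv_mul_cancel₀ hs0, one_smul] at h2
  have key := h ⟨x, ⟨hB, hAB⟩, hA, hBA'⟩
  have e1 : commutator ((s : ℂ) • A) B ⟨x, ⟨hB, hAB⟩, hA, hBA⟩ =
      (s : ℂ) • commutator A B ⟨x, ⟨hB, hAB⟩, hA, hBA'⟩ := by
    change (s : ℂ) • A ⟨B ⟨x, hB⟩, hAB⟩ - B ⟨(s : ℂ) • A ⟨x, hA⟩, hBA⟩ =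
      (s : ℂ) • (A ⟨B ⟨x, hB⟩, hAB⟩ - B ⟨A ⟨x, hA⟩, hBA'⟩)
    rw [smul_sub, ← B.map_smul]
    rfl
  rw [e1, norm_smul, Complex.norm_real, Real.norm_of_nonneg hs.le]
  calc s * ‖commutator A B ⟨x, ⟨hB, hAB⟩, hA, hBA'⟩‖ ≤ s * (c * ‖x‖) := by gcongr
    _ = (s * c) * ‖x‖ := by ring
    _ ≤ δ * ‖x‖ := by gcongr

/-- The closed operator `C`, the closure of `A - iB` (which has domain `D(A) ∩ D(B)`). -/
def opC (A B : H →ₗ.[ℂ] H) : H →ₗ.[ℂ] H := (A - Complex.I • B).closure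

/-- `T` is the bounded everywhere defined inverse of the unbounded operator `D`. -/
def IsBoundedInverse (D : H →ₗ.[ℂ] H) (T : H →L[ℂ] H) : Prop :=
  (∀ x : H, ∃ hx : T x ∈ D.domain, D ⟨T x, hx⟩ = x) ∧ ∀ y : D.domain, T (D y) = y

variable [CompleteSpace H]

/-- `Δ = 1 + C*C`, that is `1 + (A + iB)(A - iB)`, on the domain of `C*C`. -/
def delta (A B : H →ₗ.[ℂ] H) : H →ₗ.[ℂ] H :=
  (LinearMap.id : H →ₗ[ℂ] H) +ᵥ pcomp (opC A B)† (opC A B)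

/-- The standing assumptions on a pair of self-adjoint operators. -/
structure Admissible (A B : H →ₗ.[ℂ] H) : Prop where
  selfAdjoint_left : IsSelfAdjoint A
  selfAdjoint_right : IsSelfAdjoint B
  dense_domain : Dense ((A.domain ⊓ B.domain : Submodule ℂ H) : Set H)
  dense_commutator : Dense ((commutator A B).domain : Set H)
  bounded_commutator : ∃ c : ℝ, CommutatorBound A B c
  compact_inverse : ∃ T : H →L[ℂ] H, IsBoundedInverse (delta A B) T ∧ IsCompactOperator T

/-- The operator on the Hilbert space `H ⊕ H` with operator matrix `(a, b; c, d)`. -/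
def blockOp (a b c d : H →L[ℂ] H) : WithLp 2 (H × H) →L[ℂ] WithLp 2 (H × H) :=
  ((WithLp.prodContinuousLinearEquiv 2 ℂ H H).symm : H × H →L[ℂ] WithLp 2 (H × H)) ∘L
    ((a ∘L ContinuousLinearMap.fst ℂ H H + b ∘L ContinuousLinearMap.snd ℂ H H).prod
      (c ∘L ContinuousLinearMap.fst ℂ H H + d ∘L ContinuousLinearMap.snd ℂ H H)) ∘L
    ((WithLp.prodContinuousLinearEquiv 2 ℂ H H) : WithLp 2 (H × H) →L[ℂ] H × H)

/-- `Q` is the operator `(Δ⁻¹, CΔ⁻¹; Δ⁻¹C*, 1 - Δ⁻¹)` on `H ⊕ H`. Here `T = Δ⁻¹`, `S = CΔ⁻¹`, and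
the bounded extension of the densely defined operator `Δ⁻¹C*` is the adjoint of `S`. -/
def IsQ (A B : H →ₗ.[ℂ] H) (Q : WithLp 2 (H × H) →L[ℂ] WithLp 2 (H × H)) : Prop :=
  ∃ T S : H →L[ℂ] H, IsBoundedInverse (delta A B) T ∧
    (∀ x : H, ∃ hx : T x ∈ (opC A B).domain, S x = opC A B ⟨T x, hx⟩) ∧
    Q = blockOp T S (ContinuousLinearMap.adjoint S) (1 - T)

/-- The orthonormal basis `e₀ ⊕ 0, …, e_{N-1} ⊕ 0, 0 ⊕ e₀, …, 0 ⊕ e_{N-1}` of `L_N ⊕ L_N`. -/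
def cornerVec (e : HilbertBasis ℕ ℂ H) (N : ℕ) : Fin N ⊕ Fin N → WithLp 2 (H × H)
  | Sum.inl i => WithLp.toLp 2 (e i, 0)
  | Sum.inr i => WithLp.toLp 2 (0, e i)

/-- The matrix of the compression `q₁₁` of `Q` to `L_N ⊕ L_N`. -/
def corner (Q : WithLp 2 (H × H) →L[ℂ] WithLp 2 (H × H)) (e : HilbertBasis ℕ ℂ H) (N : ℕ) :
    Matrix (Fin N ⊕ Fin N) (Fin N ⊕ Fin N) ℂ :=
  Matrix.of fun i j => ⟪cornerVec e N i, Q (cornerVec e N j)⟫_ℂ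

/-- The invariant of a pair with small commutator equals `k`: the operator `Q` satisfies
`‖Q² - Q‖ < 1/4` and, for every orthonormal basis and all sufficiently large `N`, one has
`‖q₁₁² - q₁₁‖ < 1/4` and `M_N - N = k`, where `M_N` is the number of eigenvalues of `q₁₁` greater
than `1/2`, counted with multiplicity. -/
def IsOmegaSmall (A B : H →ₗ.[ℂ] H) (k : ℤ) : Prop :=
  ∃ Q : WithLp 2 (H × H) →L[ℂ] WithLp 2 (H × H), IsQ A B Q ∧ ‖Q * Q - Q‖ < 1 / 4 ∧
    ∀ e : HilbertBasis ℕ ℂ H, ∀ᶠ N : ℕ in atTop,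
      ‖Matrix.toEuclideanCLM (n := Fin N ⊕ Fin N) (𝕜 := ℂ)
        (corner Q e N * corner Q e N - corner Q e N)‖ < 1 / 4 ∧
      ∃ hq : (corner Q e N).IsHermitian,
        ((Finset.univ.filter fun i => 1 / 2 < hq.eigenvalues i).card : ℤ) - N = k

/-- `ω(A,B) = k`: the pair satisfies the standing assumptions, the space has an orthonormal basis
indexed by `ℕ`, and all rescaled pairs `(sA, tB)`, `s, t > 0`, with sufficiently small commutator
have invariant `k`. -/
def IsOmega (A B : H →ₗ.[ℂ] H) (k : ℤ) : Prop :=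
  Admissible A B ∧ Nonempty (HilbertBasis ℕ ℂ H) ∧
    ∃ δ : ℝ, 0 < δ ∧ ∀ s t : ℝ, 0 < s → 0 < t →
      CommutatorBound ((s : ℂ) • A) ((t : ℂ) • B) δ →
        IsOmegaSmall ((s : ℂ) • A) ((t : ℂ) • B) k

theorem IsQ.unique {A B : H →ₗ.[ℂ] H} {Q Q' : WithLp 2 (H × H) →L[ℂ] WithLp 2 (H × H)}
    (h : IsQ A B Q) (h' : IsQ A B Q') : Q = Q' := by
  obtain ⟨T, S, hT, hS, rfl⟩ := h
  obtain ⟨T', S', hT', hS', rfl⟩ := h'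
  have e1 : T = T' := by
    ext x
    obtain ⟨hx, hx'⟩ := hT.1 x
    have := hT'.2 ⟨T x, hx⟩
    rw [hx'] at this
    exact this.symm
  subst e1
  have e2 : S = S' := by
    ext x
    obtain ⟨_, h1⟩ := hS x
    obtain ⟨_, h2⟩ := hS' x
    rw [h1, h2]
  rw [e2]

theorem IsOmegaSmall.unique {A B : H →ₗ.[ℂ] H} {k l : ℤ} (e : HilbertBasis ℕ ℂ H)
    (hk : IsOmegaSmall A B k) (hl : IsOmegaSmall A B l) : k = l := by
  obtain ⟨Q, hQ, -, h⟩ := hk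
  obtain ⟨Q', hQ', -, h'⟩ := hl
  obtain rfl := hQ.unique hQ'
  obtain ⟨N, ⟨-, _, h1⟩, -, _, h2⟩ := ((h e).and (h' e)).exists
  exact h1.symm.trans h2

/-- The invariant is well defined. -/
theorem IsOmega.unique {A B : H →ₗ.[ℂ] H} {k l : ℤ} (hk : IsOmega A B k) (hl : IsOmega A B l) :
    k = l := by
  obtain ⟨hAd, ⟨e⟩, δ, hδ, h⟩ := hk
  obtain ⟨-, -, δ', hδ', h'⟩ := hl
  obtain ⟨c, hc⟩ := hAd.bounded_commutator
  have hm : 0 < min δ δ' := lt_min hδ hδ'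
  have hs : 0 < min δ δ' / (|c| + 1) := by positivity
  have hb : min δ δ' / (|c| + 1) * c ≤ min δ δ' := by
    rw [div_mul_eq_mul_div, div_le_iff₀ (by positivity)]
    have := le_abs_self c
    gcongr
    linarith
  have h1 := h _ 1 hs one_pos
  have h2 := h' _ 1 hs one_pos
  simp only [Complex.ofReal_one, one_smul] at h1 h2
  exact IsOmegaSmall.unique e (h1 (hc.smul hs (hb.trans (min_le_left _ _))))
    (h2 (hc.smul hs (hb.trans (min_le_right _ _))))

end Abstract

/-- The Hilbert space `L²(ℝ)` of complex valued functions. -/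
abbrev L2R : Type := Lp ℂ 2 (volume : Measure ℝ)

/-- The graph of multiplication by `x`, on its maximal domain. -/
def positionGraph : Submodule ℂ (L2R × L2R) where
  carrier := {p | p.2 =ᵐ[volume] fun x : ℝ => (x : ℂ) * p.1 x}
  zero_mem' := by
    change ((0 : L2R) : ℝ → ℂ) =ᵐ[volume] fun x : ℝ => (x : ℂ) * (0 : L2R) x
    refine Eventually.of_forall fun x => ?_
    simp
  add_mem' := by
    intro p q hp hq
    filter_upwards [hp, hq, Lp.coeFn_add p.1 q.1, Lp.coeFn_add p.2 q.2] with x h1 h2 h3 h4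
    simp only [Prod.fst_add, Prod.snd_add, h3, h4, Pi.add_apply, h1, h2, mul_add]
  smul_mem' := by
    intro c p hp
    filter_upwards [hp, Lp.coeFn_smul c p.1, Lp.coeFn_smul c p.2] with x h1 h3 h4
    simp only [Prod.smul_fst, Prod.smul_snd, h3, h4, Pi.smul_apply, h1, smul_eq_mul]
    ring

/-- `g` is the weak derivative of `f`, tested against smooth compactly supported functions. -/
def IsWeakDeriv (f g : L2R) : Prop :=
  ∀ φ : ℝ → ℂ, ContDiff ℝ (⊤ : ℕ∞) φ → HasCompactSupport φ →
    ∫ x, f x * deriv φ x = -∫ x, g x * φ x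

theorem integrable_mul_test (f : L2R) {φ : ℝ → ℂ} (hφ : Continuous φ) (hc : HasCompactSupport φ) :
    Integrable (fun x => f x * φ x) :=
  (Lp.memLp f).integrable_mul (q := 2) (hφ.memLp_of_hasCompactSupport hc)

/-- The graph of `-i d/dx`, with domain the functions in `L²(ℝ)` whose weak derivative is in
`L²(ℝ)`: a pair `(f, g)` belongs to it if `f' = i g`. -/
def momentumGraph : Submodule ℂ (L2R × L2R) where
  carrier := {p | IsWeakDeriv p.1 (Complex.I • p.2)}
  zero_mem' := by
    intro φ _ _
    simp
  add_mem' := by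
    intro p q hp hq φ h1 h2
    have hadd : ∀ (f g : L2R) {ψ : ℝ → ℂ}, Continuous ψ → HasCompactSupport ψ →
        ∫ x, (f + g) x * ψ x = (∫ x, f x * ψ x) + ∫ x, g x * ψ x := fun f g ψ c1 c2 => by
      rw [← integral_add (integrable_mul_test f c1 c2) (integrable_mul_test g c1 c2)]
      refine integral_congr_ae ?_
      filter_upwards [Lp.coeFn_add f g] with x hx
      rw [hx, Pi.add_apply, add_mul]
    rw [Prod.fst_add, Prod.snd_add, smul_add, hadd _ _ (h1.continuous_deriv (by simp)) h2.deriv,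
      hadd _ _ h1.continuous h2, hp φ h1 h2, hq φ h1 h2, neg_add]
  smul_mem' := by
    intro c p hp φ h1 h2
    have hsm : ∀ (f : L2R) (ψ : ℝ → ℂ), ∫ x, (c • f) x * ψ x = c * ∫ x, f x * ψ x := fun f ψ => by
      rw [← integral_const_mul]
      refine integral_congr_ae ?_
      filter_upwards [Lp.coeFn_smul c f] with x hx
      rw [hx, Pi.smul_apply, smul_eq_mul, mul_assoc]
    rw [Prod.smul_fst, Prod.smul_snd, smul_comm, hsm, hsm, hp φ h1 h2, mul_neg]

/-- The position operator `x` on `L²(ℝ)`. -/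
def position : L2R →ₗ.[ℂ] L2R := positionGraph.toLinearPMap

/-- The momentum operator `-i d/dx` on `L²(ℝ)`. -/
def momentum : L2R →ₗ.[ℂ] L2R := momentumGraph.toLinearPMap

theorem position_graph : position.graph = positionGraph := by
  refine Submodule.toLinearPMap_graph_eq _ ?_
  rintro ⟨f, g⟩ hp (rfl : f = 0)
  refine Lp.ext ?_
  have hp' : g =ᵐ[volume] fun x : ℝ => (x : ℂ) * (0 : L2R) x := hp
  filter_upwards [hp'] with x h1
  simp [h1]

theorem momentum_graph : momentum.graph = momentumGraph := by
  refine Submodule.toLinearPMap_graph_eq _ ?_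
  rintro ⟨f, g⟩ hp (rfl : f = 0)
  have hp' : IsWeakDeriv 0 (Complex.I • g) := hp
  have h0 : ∀ ψ : ℝ → ℂ, ∫ x, (0 : L2R) x * ψ x = 0 := fun ψ => by simp
  have hI : Complex.I • g = 0 := by
    refine Lp.ext ?_
    have hz : ∀ᵐ x, (Complex.I • g : L2R) x = 0 := by
      refine ae_eq_zero_of_integral_contDiff_smul_eq_zero
        ((Lp.memLp _).locallyIntegrable (by norm_num)) fun ψ h1 h2 => ?_
      have h3 := hp' (fun x => (ψ x : ℂ)) (Complex.ofRealCLM.contDiff.comp h1)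
        (h2.comp_left Complex.ofReal_zero)
      rw [h0, eq_comm, neg_eq_zero] at h3
      rw [← h3]
      refine integral_congr_ae (ae_of_all _ fun x => ?_)
      simp [mul_comm]
    filter_upwards [hz] with x h1
    simp [h1]
  exact (smul_eq_zero.mp hI).resolve_left Complex.I_ne_zero

end Bott

end

/-! For `s, t > 0` the pair `(s x, -i t d/dx)` is a harmonic oscillator. In the Hermite basis for
the weight `exp(-βx²)`, `β = s/t`, the operator `C = s x - t d/dx` is the creation operator `h_n ↦
√(ε(n+1)) h_{n+1}` with `ε = 2st` (`isOscillator_position_momentum`). The commutator equals `i s t`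
on Hermite functions, so a bound `δ` on it forces `s t ≤ δ` (`le_of_commutatorBound`). It remains to
study one oscillator with small `ε` (`IsOscillator.isOmegaSmall`).

Let `T = (1 + C*C)⁻¹`, `S = CT` and `T' = (1 + CC*)⁻¹`. The operator `P` with blocks `T', S, S*, 1 -
T` is an exact projection, and `Q` differs from it only by `E = T - T'` in the first corner. Since
`C*C` and `CC*` differ by `ε`, `‖E‖ ≤ ε`, and `Q` is nearly idempotent
(`norm_oscillator_sq_sub_lt`). The entries `T`, `S`, `S*` are compact, so large corners inherit this
(`eventually_norm_corner_sq_sub_lt`).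

The range of `P` is the graph of `C*`. With the compact operator `R = C(C*C)⁻¹` it consists of the
vectors `(α h_0 + Rv, v)`, while the kernel consists of the vectors `(u, -R*u)` with `u ⊥ h_0`.
Because `R` is compact, vectors with `v` or `u` in `L_N` almost lie in `L_N ⊕ L_N` when `N` is
large. This yields a space of dimension `N + 1` where the form of `q₁₁` exceeds `1/2`, and one of
dimension at least `N - 1` where it is below `1/2`. The total dimension is `2N`, so exactly `N + 1`
eigenvalues exceed `1/2` (`eventually_card_eigenvalues`). The surplus is the line `ker C* = ℂ h_0`.

The analytic input is the self-adjointness of `-i d/dx`, by von Neumann's criterion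
(`adjoint_symmetric_of_deficiency`), and the completeness of the Hermite functions, by injectivity
of the Fourier transform (`exists_hermiteBasis`). -/

noncomputable section

namespace Bott

/-! ### Diagonal operators and shifts along a Hilbert basis. -/

section Diagonal

open Topology

variable {H : Type*} [NormedAddCommGroup H] [InnerProductSpace ℂ H]

/-- Reduces every operator identity below to scalar identities between weights. -/
theorem hilbertBasis_clm_ext {F : Type*} [NormedAddCommGroup F] [NormedSpace ℂ F]
    (h : HilbertBasis ℕ ℂ H) {K L : H →L[ℂ] F} (hKL : ∀ n, K (h n) = L (h n)) : K = L := by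
  refine ContinuousLinearMap.ext_on (s := Set.range h) ?_ ?_
  · have := h.dense_span
    rwa [← Submodule.dense_iff_topologicalClosure_eq_top] at this
  · rintro _ ⟨n, rfl⟩
    exact hKL n

theorem hilbertBasis_ext (h : HilbertBasis ℕ ℂ H) {x y : H}
    (hxy : ∀ n, ⟪h n, x⟫_ℂ = ⟪h n, y⟫_ℂ) : x = y := by
  apply h.repr.injective
  ext n
  rw [h.repr_apply_apply, h.repr_apply_apply, hxy]

theorem hilbertBasis_hasSum_norm_sq (h : HilbertBasis ℕ ℂ H) (x : H) :
    HasSum (fun n => ‖⟪h n, x⟫_ℂ‖ ^ 2) (‖x‖ ^ 2) := by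
  have := h.hasSum_inner_mul_inner x x
  rw [inner_self_eq_norm_sq_to_K] at this
  have h2 := Complex.hasSum_re this
  convert h2 using 1
  · ext n
    rw [← inner_conj_symm x (h n), mul_comm, Complex.mul_conj, Complex.normSq_eq_norm_sq]
    norm_cast
  · simp [← Complex.ofReal_pow]

theorem inner_basis_diagonal (h : HilbertBasis ℕ ℂ H) {w : ℕ → ℝ} {D : H →L[ℂ] H}
    (hD : ∀ n, D (h n) = (w n : ℂ) • h n) (n : ℕ) (x : H) :
    ⟪h n, D x⟫_ℂ = w n * ⟪h n, x⟫_ℂ := by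
  have : (innerSL ℂ (h n)) ∘L D = (w n : ℂ) • innerSL ℂ (h n) := by
    refine hilbertBasis_clm_ext h fun m => ?_
    simp only [ContinuousLinearMap.comp_apply, hD, map_smul, innerSL_apply_apply,
      smul_apply, smul_eq_mul]
    rcases eq_or_ne n m with rfl | hnm
    · rfl
    · rw [h.orthonormal.2 hnm, mul_zero, mul_zero]
  exact congrArg (fun f => f x) this

theorem norm_diagonal_le (h : HilbertBasis ℕ ℂ H) {w : ℕ → ℝ} {D : H →L[ℂ] H} {M : ℝ}
    (hD : ∀ n, D (h n) = (w n : ℂ) • h n) (hM : 0 ≤ M) (hw : ∀ n, |w n| ≤ M) : ‖D‖ ≤ M := by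
  refine D.opNorm_le_bound hM fun x => ?_
  refine le_of_sq_le_sq ?_ (by positivity)
  rw [mul_pow]
  refine hasSum_le (fun n => ?_) (hilbertBasis_hasSum_norm_sq h (D x))
    ((hilbertBasis_hasSum_norm_sq h x).mul_left (M ^ 2))
  rw [inner_basis_diagonal h hD, norm_mul, mul_pow, Complex.norm_real]
  gcongr
  exact hw n

/-- Bounded diagonal operators exist. -/
theorem exists_diagonal (h : HilbertBasis ℕ ℂ H) (w : ℕ → ℝ) {M : ℝ} (hw : ∀ n, |w n| ≤ M) :
    ∃ D : H →L[ℂ] H, ∀ n, D (h n) = (w n : ℂ) • h n := by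
  have hM : 0 ≤ M := (abs_nonneg _).trans (hw 0)
  have hb : ∀ (f : lp (fun _ : ℕ => ℂ) 2) (n : ℕ), ‖(w n : ℂ) * f n‖ ≤ ‖((M : ℂ) • f) n‖ := by
    intro f n
    rw [norm_mul, Complex.norm_real, lp.coeFn_smul, Pi.smul_apply, norm_smul, Complex.norm_real,
      Real.norm_of_nonneg hM]
    gcongr
    exact hw n
  let D₀ : lp (fun _ : ℕ => ℂ) 2 →ₗ[ℂ] lp (fun _ : ℕ => ℂ) 2 :=
    { toFun := fun f => ⟨fun n => (w n : ℂ) * f n, (lp.memℓp ((M : ℂ) • f)).mono' (hb f)⟩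
      map_add' := fun f g => by
        ext n
        change (w n : ℂ) * (f n + g n) = (w n : ℂ) * f n + (w n : ℂ) * g n
        ring
      map_smul' := fun c f => by
        ext n
        change (w n : ℂ) * (c * f n) = c * ((w n : ℂ) * f n)
        ring }
  have hD₀ : ∀ f, ‖D₀ f‖ ≤ M * ‖f‖ := by
    intro f
    have := lp.norm_mono (p := 2) (by norm_num) (x := D₀ f) (y := (M : ℂ) • f) (hb f)
    rwa [norm_smul, Complex.norm_real, Real.norm_of_nonneg hM] at this
  let D₁ := D₀.mkContinuous M hD₀
  refine ⟨(h.repr.symm : _ →L[ℂ] H) ∘L D₁ ∘L (h.repr : H →L[ℂ] _), fun n => ?_⟩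
  apply h.repr.injective
  ext m
  change h.repr (h.repr.symm (D₀ (h.repr (h n)))) m = _
  rw [LinearIsometryEquiv.apply_symm_apply]
  change (w m : ℂ) * h.repr (h n) m = _
  rw [map_smul, lp.coeFn_smul, Pi.smul_apply, smul_eq_mul, h.repr_apply_apply]
  rcases eq_or_ne m n with rfl | hnm
  · rfl
  · rw [h.orthonormal.2 hnm, mul_zero, mul_zero]

/-- A diagonal operator whose entries tend to zero is compact. -/
theorem isCompactOperator_diagonal [CompleteSpace H] (h : HilbertBasis ℕ ℂ H) {w : ℕ → ℝ}
    {D : H →L[ℂ] H} (hD : ∀ n, D (h n) = (w n : ℂ) • h n) (hw : Tendsto w atTop (𝓝 0)) :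
    IsCompactOperator D := by
  let K : ℕ → H →L[ℂ] H := fun m =>
    ∑ n ∈ Finset.range m, (w n : ℂ) • (innerSL ℂ (h n)).smulRight (h n)
  have hKb : ∀ m n, K m (h n) = if n < m then (w n : ℂ) • h n else 0 := by
    intro m n
    simp only [K, sum_apply, smul_apply,
      ContinuousLinearMap.smulRight_apply, innerSL_apply_apply]
    have : ∀ k, (w k : ℂ) • ⟪h k, h n⟫_ℂ • h k = if k = n then (w n : ℂ) • h n else 0 := by
      intro k
      split_ifs with hk
      · subst hk
        rw [inner_self_eq_norm_sq_to_K, h.orthonormal.1]; simp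
      · rw [h.orthonormal.2 hk, zero_smul, smul_zero]
    simp only [this, Finset.sum_ite_eq', Finset.mem_range]
  have hKc : ∀ m, IsCompactOperator (K m) := by
    intro m
    have : K m ∈ compactOperator (RingHom.id ℂ) H H := by
      refine Submodule.sum_mem _ fun n _ => Submodule.smul_mem _ _ ?_
      have h1 : IsCompactOperator (ContinuousLinearMap.toSpanSingleton ℂ (h n)) :=
        isCompactOperator_of_locallyCompactSpace_rng _
      exact h1.comp_clm (innerSL ℂ (h n))
    exact this
  refine isCompactOperator_of_tendsto (F := K) (l := atTop) ?_ (Eventually.of_forall hKc)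
  rw [tendsto_iff_norm_sub_tendsto_zero]
  rw [Metric.tendsto_atTop] at hw ⊢
  intro ε hε
  obtain ⟨N, hN⟩ := hw (ε / 2) (by positivity)
  refine ⟨N, fun m hm => ?_⟩
  rw [Real.dist_eq, sub_zero, abs_norm]
  refine lt_of_le_of_lt ?_ (half_lt_self hε)
  -- The difference `K m - D` is again diagonal: it vanishes below `m` and has entries at most `ε /
  -- 2` beyond.
  refine norm_diagonal_le h (w := fun n => if n < m then 0 else - w n) (fun n => ?_) (by positivity)
    fun n => ?_
  · rw [sub_apply, hKb, hD]
    split_ifs <;> simp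
  · split_ifs with hn
    · simp only [abs_zero]; positivity
    · rw [abs_neg]
      have := hN n (by omega)
      rw [Real.dist_eq, sub_zero] at this
      exact this.le

/-- The unilateral shift along a Hilbert basis. -/
theorem exists_shift [CompleteSpace H] (h : HilbertBasis ℕ ℂ H) :
    ∃ U : H →ₗᵢ[ℂ] H, ∀ n, U (h n) = h (n + 1) := by
  have ho : Orthonormal ℂ fun n : ℕ => h (n + 1) :=
    h.orthonormal.comp _ (add_left_injective 1)
  let V := (ho.orthogonalFamily).linearIsometry
  refine ⟨V.comp h.repr.toLinearIsometry, fun n => ?_⟩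
  change V (h.repr (h n)) = _
  rw [h.repr_self]
  rw [OrthogonalFamily.linearIsometry_apply_single]
  simp

end Diagonal

/-! ### Counting eigenvalues by dimensions of definite subspaces. -/

section Inertia

variable {n : Type*} [Fintype n] [DecidableEq n] {M : Matrix n n ℂ}
  {V : Type*} [AddCommGroup V] [Module ℂ V]

theorem inner_eigenvectorBasis_toEuclideanCLM (hM : M.IsHermitian) (i : n)
    (x : EuclideanSpace ℂ n) :
    ⟪hM.eigenvectorBasis i, Matrix.toEuclideanCLM (𝕜 := ℂ) M x⟫_ℂ =
      hM.eigenvalues i * ⟪hM.eigenvectorBasis i, x⟫_ℂ := by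
  have h1 : ⟪Matrix.toEuclideanCLM (𝕜 := ℂ) M (hM.eigenvectorBasis i), x⟫_ℂ =
      ⟪hM.eigenvectorBasis i, Matrix.toEuclideanCLM (𝕜 := ℂ) M x⟫_ℂ :=
    Matrix.isSymmetric_toEuclideanLin_iff.mpr hM _ _
  have h2 : Matrix.toEuclideanCLM (𝕜 := ℂ) M (hM.eigenvectorBasis i) =
      (hM.eigenvalues i : ℂ) • hM.eigenvectorBasis i := by
    apply (WithLp.linearEquiv 2 ℂ (n → ℂ)).injective
    exact hM.mulVec_eigenvectorBasis i
  rw [← h1, h2, inner_smul_left, Complex.conj_ofReal]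

theorem re_inner_toEuclideanCLM (hM : M.IsHermitian) (x : EuclideanSpace ℂ n) :
    (⟪x, Matrix.toEuclideanCLM (𝕜 := ℂ) M x⟫_ℂ).re =
      ∑ i, hM.eigenvalues i * ‖⟪hM.eigenvectorBasis i, x⟫_ℂ‖ ^ 2 := by
  rw [← hM.eigenvectorBasis.sum_inner_mul_inner, Complex.re_sum]
  refine Finset.sum_congr rfl fun i _ => ?_
  rw [inner_eigenvectorBasis_toEuclideanCLM, ← inner_conj_symm x, mul_left_comm,
    mul_comm (starRingEnd ℂ _), Complex.mul_conj, Complex.normSq_eq_norm_sq]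
  norm_cast

theorem norm_sq_eq_sum_eigenvectorBasis (hM : M.IsHermitian) (x : EuclideanSpace ℂ n) :
    ‖x‖ ^ 2 = ∑ i, ‖⟪hM.eigenvectorBasis i, x⟫_ℂ‖ ^ 2 :=
  (hM.eigenvectorBasis.sum_sq_norm_inner_right x).symm

/-- The coefficients along the eigenvectors indexed by `s` give an injective linear map into `ℂ^s`.
This is the dimension count behind the min-max principle. -/
theorem finrank_le_card_of_coefficients (hM : M.IsHermitian) (s : Finset n)
    (f : V →ₗ[ℂ] EuclideanSpace ℂ n)
    (hf : ∀ v, (∀ i ∈ s, ⟪hM.eigenvectorBasis i, f v⟫_ℂ = 0) → v = 0) :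
    Module.finrank ℂ V ≤ s.card := by
  let π : V →ₗ[ℂ] (s → ℂ) :=
    LinearMap.pi fun i => (innerSL ℂ (hM.eigenvectorBasis i)).toLinearMap ∘ₗ f
  have hπ : Function.Injective π := by
    rw [← LinearMap.ker_eq_bot, LinearMap.ker_eq_bot']
    exact fun v hv => hf v fun i hi => congrFun hv ⟨i, hi⟩
  simpa using LinearMap.finrank_le_finrank_of_injective hπ

/-- A space on which the form of `M` exceeds `c` has dimension at most the number of eigenvalues
greater than `c`. -/
theorem finrank_le_card_eigenvalues_gt (hM : M.IsHermitian) (c : ℝ)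
    (f : V →ₗ[ℂ] EuclideanSpace ℂ n)
    (hf : ∀ v ≠ 0, c * ‖f v‖ ^ 2 < (⟪f v, Matrix.toEuclideanCLM (𝕜 := ℂ) M (f v)⟫_ℂ).re) :
    Module.finrank ℂ V ≤ (Finset.univ.filter fun i => c < hM.eigenvalues i).card := by
  refine finrank_le_card_of_coefficients hM _ f fun v hv => ?_
  by_contra hne
  have h1 := hf v hne
  rw [re_inner_toEuclideanCLM hM, norm_sq_eq_sum_eigenvectorBasis hM, Finset.mul_sum] at h1
  refine absurd h1 (not_lt.mpr (Finset.sum_le_sum fun i _ => ?_))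
  by_cases hi : c < hM.eigenvalues i
  · rw [hv i (by simpa using hi)]; simp
  · gcongr
    exact not_lt.mp hi

/-- A space on which the form of `M` is less than `c` has dimension at most the number of
eigenvalues not greater than `c`. -/
theorem finrank_le_card_eigenvalues_le (hM : M.IsHermitian) (c : ℝ)
    (f : V →ₗ[ℂ] EuclideanSpace ℂ n)
    (hf : ∀ v ≠ 0, (⟪f v, Matrix.toEuclideanCLM (𝕜 := ℂ) M (f v)⟫_ℂ).re < c * ‖f v‖ ^ 2) :
    Module.finrank ℂ V ≤ (Finset.univ.filter fun i => ¬ c < hM.eigenvalues i).card := by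
  refine finrank_le_card_of_coefficients hM _ f fun v hv => ?_
  by_contra hne
  have h1 := hf v hne
  rw [re_inner_toEuclideanCLM hM, norm_sq_eq_sum_eigenvectorBasis hM, Finset.mul_sum] at h1
  refine absurd h1 (not_lt.mpr (Finset.sum_le_sum fun i _ => ?_))
  by_cases hi : c < hM.eigenvalues i
  · gcongr
  · rw [hv i (by simpa using hi)]; simp

end Inertia

/-! ### Truncation to the first `N` basis vectors. -/

section Truncation

open Topology

variable {H : Type*} [NormedAddCommGroup H] [InnerProductSpace ℂ H]

/-- The orthogonal projection onto the span of the first `N` basis vectors. -/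
def trunc (e : HilbertBasis ℕ ℂ H) (N : ℕ) : H →L[ℂ] H :=
  ∑ i : Fin N, (innerSL ℂ (e i)).smulRight (e i)

theorem trunc_apply (e : HilbertBasis ℕ ℂ H) (N : ℕ) (x : H) :
    trunc e N x = ∑ i : Fin N, ⟪e i, x⟫_ℂ • e i := by
  simp [trunc]

theorem tendsto_trunc (e : HilbertBasis ℕ ℂ H) (x : H) :
    Tendsto (fun N => trunc e N x) atTop (𝓝 x) := by
  have := (e.hasSum_repr x).tendsto_sum_nat
  refine this.congr fun N => ?_
  rw [trunc_apply, ← Fin.sum_univ_eq_sum_range (fun i => e.repr x i • e i) N]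
  simp only [e.repr_apply_apply]

theorem trunc_basis (e : HilbertBasis ℕ ℂ H) (N n : ℕ) :
    trunc e N (e n) = if n < N then e n else 0 := by
  rw [trunc_apply, Fin.sum_univ_eq_sum_range (fun i => ⟪e i, e n⟫_ℂ • e i) N]
  have : ∀ k, ⟪e k, e n⟫_ℂ • e k = if k = n then e n else 0 := by
    intro k
    split_ifs with hk
    · subst hk
      rw [inner_self_eq_norm_sq_to_K, e.orthonormal.1]; simp
    · rw [e.orthonormal.2 hk, zero_smul]
  simp only [this, Finset.sum_ite_eq', Finset.mem_range]

theorem norm_one_sub_trunc_le (e : HilbertBasis ℕ ℂ H) (N : ℕ) : ‖1 - trunc e N‖ ≤ 1 := by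
  refine norm_diagonal_le e (w := fun n => if n < N then 0 else 1) (fun n => ?_) zero_le_one
    fun n => ?_
  · rw [sub_apply, trunc_basis, one_apply_eq_self]
    split_ifs <;> simp
  · split_ifs <;> simp

theorem tendsto_one_sub_trunc_apply (e : HilbertBasis ℕ ℂ H) (x : H) :
    Tendsto (fun N => ‖(1 - trunc e N) x‖) atTop (𝓝 0) := by
  have := (tendsto_const_nhds (x := x)).sub (tendsto_trunc e x)
  simpa using this.norm

/-- Strong convergence of the uniformly bounded `1 - trunc e N` to zero is uniform on totally
bounded sets, in particular on the image of the unit ball under a compact operator. A finite `ε /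
4`-net costs `ε / 4` on the net and `ε / 4` for the distance to it. -/
theorem tendsto_one_sub_trunc_comp (e : HilbertBasis ℕ ℂ H) {K : H →L[ℂ] H}
    (hK : IsCompactOperator K) :
    Tendsto (fun N => ‖(1 - trunc e N) ∘L K‖) atTop (𝓝 0) := by
  rw [Metric.tendsto_atTop]
  intro ε hε
  have hc := hK.isCompact_closure_image_closedBall (f := (K : H →ₗ[ℂ] H)) 1
  have htb := hc.totallyBounded.subset subset_closure
  obtain ⟨t, htf, ht⟩ := Metric.totallyBounded_iff.mp htb (ε / 4) (by positivity)
  have hev : ∀ᶠ N in atTop, ∀ y ∈ t, ‖(1 - trunc e N) y‖ < ε / 4 := by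
    rw [Filter.eventually_all_finite htf]
    intro y _
    exact (tendsto_one_sub_trunc_apply e y).eventually_lt_const (by positivity)
  obtain ⟨N₀, hN₀⟩ := eventually_atTop.mp hev
  refine ⟨N₀, fun N hN => ?_⟩
  rw [Real.dist_eq, sub_zero, abs_norm]
  refine lt_of_le_of_lt ?_ (half_lt_self hε)
  refine ContinuousLinearMap.opNorm_le_of_unit_norm (𝕜 := ℂ) (by positivity) fun x hx => ?_
  have hx' : K x ∈ (K : H →ₗ[ℂ] H) '' Metric.closedBall 0 1 := ⟨x, by simp [hx], rfl⟩
  obtain ⟨y, hy, hxy⟩ := Set.mem_iUnion₂.mp (ht hx')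
  have h1 : (1 - trunc e N) (K x) = (1 - trunc e N) y + (1 - trunc e N) (K x - y) := by
    rw [← map_add]; congr 1; abel
  rw [ContinuousLinearMap.comp_apply, h1]
  refine (norm_add_le _ _).trans ?_
  have h2 := hN₀ N hN y hy
  have h3 := (1 - trunc e N).le_of_opNorm_le (norm_one_sub_trunc_le e N) (K x - y)
  rw [Metric.mem_ball, dist_eq_norm] at hxy
  linarith

end Truncation

/-! ### Compression to `L_N ⊕ L_N`. -/

section Corner

open Topology

variable {H : Type*} [NormedAddCommGroup H]

theorem norm_toLp_prod_le (x y : H) : ‖WithLp.toLp 2 (x, y)‖ ≤ ‖x‖ + ‖y‖ := by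
  rw [WithLp.prod_norm_eq_of_L2]
  refine Real.sqrt_le_iff.mpr ⟨by positivity, ?_⟩
  simp only [WithLp.toLp_fst, WithLp.toLp_snd]
  nlinarith [norm_nonneg x, norm_nonneg y]

theorem norm_fst_le_toLp (x y : H) : ‖x‖ ≤ ‖WithLp.toLp 2 (x, y)‖ := by
  rw [WithLp.prod_norm_eq_of_L2]
  refine Real.le_sqrt_of_sq_le ?_
  simp only [WithLp.toLp_fst, WithLp.toLp_snd]
  nlinarith [norm_nonneg x, norm_nonneg y]

theorem norm_snd_le_toLp (x y : H) : ‖y‖ ≤ ‖WithLp.toLp 2 (x, y)‖ := by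
  rw [WithLp.prod_norm_eq_of_L2]
  refine Real.le_sqrt_of_sq_le ?_
  simp only [WithLp.toLp_fst, WithLp.toLp_snd]
  nlinarith [norm_nonneg x, norm_nonneg y]

variable [InnerProductSpace ℂ H]

theorem blockOp_apply (a b c d : H →L[ℂ] H) (x y : H) :
    blockOp a b c d (WithLp.toLp 2 (x, y)) = WithLp.toLp 2 (a x + b y, c x + d y) := rfl

theorem orthonormal_cornerVec (e : HilbertBasis ℕ ℂ H) (N : ℕ) :
    Orthonormal ℂ (cornerVec e N) := by
  rw [orthonormal_iff_ite]
  have he := orthonormal_iff_ite.mp e.orthonormal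
  rintro (i | i) (j | j)
  · simp only [cornerVec, WithLp.prod_inner_apply, inner_zero_left, add_zero, he, Sum.inl.injEq,
      Fin.val_inj]
  · simp [cornerVec, WithLp.prod_inner_apply]
  · simp [cornerVec, WithLp.prod_inner_apply]
  · simp only [cornerVec, WithLp.prod_inner_apply, inner_zero_left, zero_add, he, Sum.inr.injEq,
      Fin.val_inj]

/-- The isometric inclusion of `L_N ⊕ L_N`, in coordinates. -/
def cornerEmb (e : HilbertBasis ℕ ℂ H) (N : ℕ) :
    EuclideanSpace ℂ (Fin N ⊕ Fin N) →L[ℂ] WithLp 2 (H × H) :=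
  ∑ i, (EuclideanSpace.proj i : EuclideanSpace ℂ (Fin N ⊕ Fin N) →L[ℂ] ℂ).smulRight
    (cornerVec e N i)

theorem cornerEmb_apply (e : HilbertBasis ℕ ℂ H) (N : ℕ)
    (x : EuclideanSpace ℂ (Fin N ⊕ Fin N)) :
    cornerEmb e N x = ∑ i, x i • cornerVec e N i := by
  simp [cornerEmb]

theorem isHermitian_corner {Q : WithLp 2 (H × H) →L[ℂ] WithLp 2 (H × H)}
    (hQ : ∀ x y, ⟪Q x, y⟫_ℂ = ⟪x, Q y⟫_ℂ) (e : HilbertBasis ℕ ℂ H) (N : ℕ) :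
    (corner Q e N).IsHermitian := by
  ext i j
  change starRingEnd ℂ ⟪cornerVec e N j, Q (cornerVec e N i)⟫_ℂ =
    ⟪cornerVec e N i, Q (cornerVec e N j)⟫_ℂ
  rw [inner_conj_symm, hQ]

variable [CompleteSpace H]

theorem adjoint_cornerEmb_apply (e : HilbertBasis ℕ ℂ H) (N : ℕ) (w : WithLp 2 (H × H))
    (i : Fin N ⊕ Fin N) :
    (ContinuousLinearMap.adjoint (cornerEmb e N) w) i = ⟪cornerVec e N i, w⟫_ℂ := by
  have h1 := EuclideanSpace.inner_single_left (𝕜 := ℂ) i 1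
    (ContinuousLinearMap.adjoint (cornerEmb e N) w)
  rw [ContinuousLinearMap.adjoint_inner_right, cornerEmb_apply] at h1
  simpa [Finset.sum_ite_eq', PiLp.single_apply, ite_smul] using h1.symm

theorem adjoint_cornerEmb_cornerEmb (e : HilbertBasis ℕ ℂ H) (N : ℕ)
    (x : EuclideanSpace ℂ (Fin N ⊕ Fin N)) :
    ContinuousLinearMap.adjoint (cornerEmb e N) (cornerEmb e N x) = x := by
  ext i
  rw [adjoint_cornerEmb_apply, cornerEmb_apply, (orthonormal_cornerVec e N).inner_right_fintype]

theorem norm_cornerEmb (e : HilbertBasis ℕ ℂ H) (N : ℕ)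
    (x : EuclideanSpace ℂ (Fin N ⊕ Fin N)) : ‖cornerEmb e N x‖ = ‖x‖ := by
  have h1 : ⟪cornerEmb e N x, cornerEmb e N x⟫_ℂ = ⟪x, x⟫_ℂ := by
    rw [← ContinuousLinearMap.adjoint_inner_right, adjoint_cornerEmb_cornerEmb]
  rw [inner_self_eq_norm_sq_to_K, inner_self_eq_norm_sq_to_K] at h1
  have h2 : ‖cornerEmb e N x‖ ^ 2 = ‖x‖ ^ 2 := by exact_mod_cast h1
  exact (sq_eq_sq₀ (norm_nonneg _) (norm_nonneg _)).mp h2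

/-- With `J = cornerEmb e N`, the projection `JJ*` truncates each summand separately, so estimates
for `trunc` transfer to the corner. -/
theorem cornerEmb_adjoint_apply (e : HilbertBasis ℕ ℂ H) (N : ℕ) (a b : H) :
    cornerEmb e N (ContinuousLinearMap.adjoint (cornerEmb e N) (WithLp.toLp 2 (a, b))) =
      WithLp.toLp 2 (trunc e N a, trunc e N b) := by
  rw [cornerEmb_apply]
  simp only [adjoint_cornerEmb_apply, Fintype.sum_sum_type, cornerVec, WithLp.prod_inner_apply,
    inner_zero_left, add_zero, zero_add, trunc_apply]
  apply (WithLp.linearEquiv 2 ℂ (H × H)).injective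
  simp [Prod.ext_iff, Prod.fst_sum, Prod.snd_sum]

/-- Writing the matrix as `J*QJ` turns questions about its norm and its form into questions about
`Q`. -/
theorem toEuclideanCLM_corner (Q : WithLp 2 (H × H) →L[ℂ] WithLp 2 (H × H))
    (e : HilbertBasis ℕ ℂ H) (N : ℕ) :
    Matrix.toEuclideanCLM (n := Fin N ⊕ Fin N) (𝕜 := ℂ) (corner Q e N) =
      ContinuousLinearMap.adjoint (cornerEmb e N) ∘L Q ∘L cornerEmb e N := by
  ext x i
  rw [ContinuousLinearMap.comp_apply, ContinuousLinearMap.comp_apply, adjoint_cornerEmb_apply,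
    cornerEmb_apply, map_sum, inner_sum, Matrix.ofLp_toEuclideanCLM, Matrix.mulVec_eq_sum]
  simp [corner, inner_smul_right]

/-- For `Q` a compact perturbation of `0 ⊕ 1`, the compression to a large corner is as close to an
idempotent as `Q` is. -/
theorem eventually_norm_corner_sq_sub_lt {T₁ S₁ S₂ T₂ : H →L[ℂ] H} (h₁ : IsCompactOperator T₁)
    (h₂ : IsCompactOperator S₁) (h₃ : IsCompactOperator S₂) (h₄ : IsCompactOperator T₂)
    {c : ℝ} {Q : WithLp 2 (H × H) →L[ℂ] WithLp 2 (H × H)} (hQ : Q = blockOp T₁ S₁ S₂ (1 - T₂))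
    (hc : ‖Q * Q - Q‖ < c) (e : HilbertBasis ℕ ℂ H) :
    ∀ᶠ N : ℕ in atTop,
      ‖Matrix.toEuclideanCLM (n := Fin N ⊕ Fin N) (𝕜 := ℂ)
        (corner Q e N * corner Q e N - corner Q e N)‖ < c := by
  have hlim := (((tendsto_one_sub_trunc_comp e h₁).add (tendsto_one_sub_trunc_comp e h₂)).add
    ((tendsto_one_sub_trunc_comp e h₃).add (tendsto_one_sub_trunc_comp e h₄))).const_mul ‖Q‖
  simp only [add_zero, mul_zero] at hlim
  filter_upwards [hlim.eventually_lt_const (sub_pos.mpr hc)] with N hN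
  refine lt_of_le_of_lt ?_ (lt_sub_iff_add_lt.mp hN)
  set r := ‖(1 - trunc e N) ∘L T₁‖ + ‖(1 - trunc e N) ∘L S₁‖ +
    (‖(1 - trunc e N) ∘L S₂‖ + ‖(1 - trunc e N) ∘L T₂‖) with hr
  have hr0 : 0 ≤ r := by positivity
  refine ContinuousLinearMap.opNorm_le_bound _ (by positivity) fun x => ?_
  rw [map_sub, map_mul, toEuclideanCLM_corner]
  set J := cornerEmb e N with hJ
  set J' := ContinuousLinearMap.adjoint J with hJ'
  have hJ'n : ∀ w, ‖J' w‖ ≤ ‖w‖ := by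
    intro w
    have h1 : ‖J‖ ≤ 1 := J.opNorm_le_bound zero_le_one fun x => by
      rw [one_mul, hJ, norm_cornerEmb]
    have h2 : ‖J'‖ ≤ 1 := by rwa [hJ', LinearIsometryEquiv.norm_map]
    simpa using J'.le_of_opNorm_le h2 w
  -- The defect of `Q` from preserving the corner comes from compact entries only: the second
  -- coordinate `b` is fixed by truncation, so the identity inside `1 - T₂` contributes nothing.
  have key : ‖Q (J x) - J (J' (Q (J x)))‖ ≤ r * ‖J x‖ := by
    obtain ⟨a, b, hab⟩ : ∃ a b, J x = WithLp.toLp 2 (a, b) := ⟨(J x).fst, (J x).snd, rfl⟩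
    have hb : trunc e N b = b := by
      have h1 := cornerEmb_adjoint_apply e N a b
      rw [← hab, hJ, adjoint_cornerEmb_cornerEmb, ← hJ, hab] at h1
      have h2 := congrArg WithLp.snd h1
      exact h2.symm
    rw [hab, hQ, blockOp_apply, cornerEmb_adjoint_apply, ← WithLp.toLp_sub, Prod.mk_sub_mk]
    refine (norm_toLp_prod_le _ _).trans ?_
    have ha' := norm_fst_le_toLp a b
    have hb' := norm_snd_le_toLp a b
    set m := ‖WithLp.toLp 2 (a, b)‖
    have bd : ∀ (K : H →L[ℂ] H) (z : H), ‖z‖ ≤ m →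
        ‖(1 - trunc e N) (K z)‖ ≤ ‖(1 - trunc e N) ∘L K‖ * m := fun K z hz =>
      (((1 - trunc e N) ∘L K).le_opNorm z).trans (by gcongr)
    have e1 : T₁ a + S₁ b - trunc e N (T₁ a + S₁ b) =
        (1 - trunc e N) (T₁ a) + (1 - trunc e N) (S₁ b) := by
      simp only [sub_apply, one_apply_eq_self, map_add]; abel
    have e2 : S₂ a + (1 - T₂) b - trunc e N (S₂ a + (1 - T₂) b) =
        (1 - trunc e N) (S₂ a) - (1 - trunc e N) (T₂ b) := by
      simp only [sub_apply, one_apply_eq_self, map_add, map_sub, hb]; abel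
    rw [e1, e2]
    refine (add_le_add (norm_add_le _ _) (norm_sub_le _ _)).trans ?_
    have := bd T₁ a ha'
    have := bd S₁ b hb'
    have := bd S₂ a ha'
    have := bd T₂ b hb'
    rw [hr]
    linarith
  -- The compressed `Q² - Q`, corrected by the part of `Q J x` that leaves the corner; the
  -- correction has norm at most `‖Q‖ r ‖x‖`.
  have hid : ((J' ∘L Q ∘L J) * (J' ∘L Q ∘L J) - J' ∘L Q ∘L J) x =
      J' ((Q * Q - Q) (J x)) - J' (Q (Q (J x) - J (J' (Q (J x))))) := by
    simp only [sub_apply, ContinuousLinearMap.mul_def, ContinuousLinearMap.comp_apply, map_sub]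
    abel
  rw [hid]
  refine (norm_sub_le _ _).trans ?_
  have hn : ‖J x‖ = ‖x‖ := norm_cornerEmb e N x
  have h5 := (hJ'n ((Q * Q - Q) (J x))).trans ((Q * Q - Q).le_opNorm (J x))
  have h6 := (hJ'n (Q (Q (J x) - J (J' (Q (J x)))))).trans (Q.le_opNorm _)
  have h7 : ‖Q‖ * ‖Q (J x) - J (J' (Q (J x)))‖ ≤ ‖Q‖ * (r * ‖J x‖) := by gcongr
  rw [hn] at h5 h7
  linarith

end Corner

/-! ### Block operators and weighted shifts. -/

section WeightedShift

open Topology ContinuousLinearMap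

variable {H : Type*} [NormedAddCommGroup H] [InnerProductSpace ℂ H]

theorem norm_blockOp_le (a b c d : H →L[ℂ] H) :
    ‖blockOp a b c d‖ ≤ ‖a‖ + ‖b‖ + (‖c‖ + ‖d‖) := by
  refine opNorm_le_bound _ (by positivity) fun w => ?_
  obtain ⟨x, y, rfl⟩ : ∃ x y, w = WithLp.toLp 2 (x, y) := ⟨w.fst, w.snd, rfl⟩
  rw [blockOp_apply]
  refine (norm_toLp_prod_le _ _).trans ?_
  have hx := norm_fst_le_toLp x y
  have hy := norm_snd_le_toLp x y
  set m := ‖WithLp.toLp 2 (x, y)‖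
  have bd : ∀ (K : H →L[ℂ] H) (z : H), ‖z‖ ≤ m → ‖K z‖ ≤ ‖K‖ * m := fun K z hz =>
    (K.le_opNorm z).trans (by gcongr)
  have h1 := bd a x hx
  have h2 := bd b y hy
  have h3 := bd c x hx
  have h4 := bd d y hy
  have h5 := norm_add_le (a x) (b y)
  have h6 := norm_add_le (c x) (d y)
  linarith

/-- Putting `w = w' + d` leaves two mixed terms and one term quadratic in `d`. Each is at most `η
‖B‖ ‖w'‖²`, the last because `η ≤ 1`. -/
theorem abs_re_inner_sub_le {E : Type*} [NormedAddCommGroup E] [InnerProductSpace ℂ E]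
    (B : E →L[ℂ] E) {w w' : E} {η : ℝ} (hη : η ≤ 1) (h : ‖w - w'‖ ≤ η * ‖w'‖) :
    |(⟪w, B w⟫_ℂ).re - (⟪w', B w'⟫_ℂ).re| ≤ 3 * η * ‖B‖ * ‖w'‖ ^ 2 := by
  obtain ⟨d, rfl⟩ : ∃ d, w = w' + d := ⟨w - w', by abel⟩
  rw [add_sub_cancel_left] at h
  have hd : ‖d‖ ≤ ‖w'‖ := h.trans (mul_le_of_le_one_left (norm_nonneg _) hη)
  have e1 : ⟪w' + d, B (w' + d)⟫_ℂ - ⟪w', B w'⟫_ℂ =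
      ⟪w', B d⟫_ℂ + ⟪d, B w'⟫_ℂ + ⟪d, B d⟫_ℂ := by
    rw [map_add, inner_add_left, inner_add_right, inner_add_right]; ring
  rw [← Complex.sub_re, e1]
  refine (Complex.abs_re_le_norm _).trans ?_
  have bd : ∀ x y : E, ‖⟪x, B y⟫_ℂ‖ ≤ ‖B‖ * (‖x‖ * ‖y‖) := fun x y =>
    (norm_inner_le_norm _ _).trans (by
      calc ‖x‖ * ‖B y‖ ≤ ‖x‖ * (‖B‖ * ‖y‖) := by gcongr; exact B.le_opNorm y
        _ = _ := by ring)
  have h1 := bd w' d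
  have h2 := bd d w'
  have h3 := bd d d
  have h4 : ‖w'‖ * ‖d‖ ≤ η * ‖w'‖ ^ 2 := by nlinarith [norm_nonneg w']
  have h5 : ‖d‖ * ‖d‖ ≤ η * ‖w'‖ ^ 2 := by nlinarith [norm_nonneg w', norm_nonneg d]
  have hB := norm_nonneg B
  calc _ ≤ ‖⟪w', B d⟫_ℂ‖ + ‖⟪d, B w'⟫_ℂ‖ + ‖⟪d, B d⟫_ℂ‖ := norm_add₃_le
    _ ≤ ‖B‖ * (η * ‖w'‖ ^ 2) + ‖B‖ * (η * ‖w'‖ ^ 2) + ‖B‖ * (η * ‖w'‖ ^ 2) := by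
        gcongr
        · exact h1.trans (by gcongr)
        · exact h2.trans (by rw [mul_comm ‖d‖]; gcongr)
        · exact h3.trans (by gcongr)
    _ = _ := by ring

variable [CompleteSpace H]

/-- The vector `h 0` is orthogonal to the range of the shift; this one missing dimension produces
the invariant `1`. -/
theorem adjoint_weightedShift_zero (h : HilbertBasis ℕ ℂ H) {w : ℕ → ℝ} {W : H →L[ℂ] H}
    (hW : ∀ n, W (h n) = (w n : ℂ) • h (n + 1)) : adjoint W (h 0) = 0 := by
  refine hilbertBasis_ext h fun k => ?_
  rw [adjoint_inner_right, hW, inner_smul_left, h.orthonormal.2 (Nat.succ_ne_zero k), mul_zero,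
    inner_zero_right]

theorem adjoint_weightedShift_succ (h : HilbertBasis ℕ ℂ H) {w : ℕ → ℝ} {W : H →L[ℂ] H}
    (hW : ∀ n, W (h n) = (w n : ℂ) • h (n + 1)) (n : ℕ) :
    adjoint W (h (n + 1)) = (w n : ℂ) • h n := by
  refine hilbertBasis_ext h fun k => ?_
  have he := orthonormal_iff_ite.mp h.orthonormal
  rw [adjoint_inner_right, hW, inner_smul_left, inner_smul_right, he, he, Complex.conj_ofReal]
  by_cases hk : k = n
  · simp [hk]
  · simp [hk]

theorem adjoint_diagonal (h : HilbertBasis ℕ ℂ H) {w : ℕ → ℝ} {D : H →L[ℂ] H}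
    (hD : ∀ n, D (h n) = (w n : ℂ) • h n) : adjoint D = D := by
  refine hilbertBasis_clm_ext h fun n => hilbertBasis_ext h fun k => ?_
  rw [adjoint_inner_right, hD, hD, inner_smul_left, inner_smul_right, Complex.conj_ofReal]
  rcases eq_or_ne k n with rfl | hkn
  · rfl
  · rw [h.orthonormal.2 hkn, mul_zero, mul_zero]

theorem exists_weightedShift (h : HilbertBasis ℕ ℂ H) (w : ℕ → ℝ) {M : ℝ}
    (hw : ∀ n, |w n| ≤ M) : ∃ W : H →L[ℂ] H, ∀ n, W (h n) = (w n : ℂ) • h (n + 1) := by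
  obtain ⟨D, hD⟩ := exists_diagonal h w hw
  obtain ⟨U, hU⟩ := exists_shift h
  refine ⟨U.toContinuousLinearMap ∘L D, fun n => ?_⟩
  rw [comp_apply, hD, map_smul]
  exact congrArg _ (hU n)

theorem norm_weightedShift_le (h : HilbertBasis ℕ ℂ H) {w : ℕ → ℝ} {W : H →L[ℂ] H} {M : ℝ}
    (hW : ∀ n, W (h n) = (w n : ℂ) • h (n + 1)) (hM : 0 ≤ M) (hw : ∀ n, |w n| ≤ M) :
    ‖W‖ ≤ M := by
  obtain ⟨D, hD⟩ := exists_diagonal h w hw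
  obtain ⟨U, hU⟩ := exists_shift h
  have e : W = U.toContinuousLinearMap ∘L D := hilbertBasis_clm_ext h fun n => by
    rw [comp_apply, hD, hW, map_smul]
    exact congrArg _ (hU n).symm
  refine opNorm_le_bound _ hM fun x => ?_
  rw [e, comp_apply]
  exact (U.norm_map (D x)).le.trans (D.le_of_opNorm_le (norm_diagonal_le h hD hM hw) x)

/-- The shift factors as `W = U D` with `U` isometric and `D` a compact diagonal operator, so `W* =
D U*` is compact too. -/
theorem isCompactOperator_weightedShift (h : HilbertBasis ℕ ℂ H) {w : ℕ → ℝ} {W : H →L[ℂ] H}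
    (hW : ∀ n, W (h n) = (w n : ℂ) • h (n + 1)) {M : ℝ} (hb : ∀ n, |w n| ≤ M)
    (hw : Tendsto w atTop (𝓝 0)) :
    IsCompactOperator W ∧ IsCompactOperator (adjoint W) := by
  obtain ⟨D, hD⟩ := exists_diagonal h w hb
  obtain ⟨U, hU⟩ := exists_shift h
  have e : W = U.toContinuousLinearMap ∘L D := hilbertBasis_clm_ext h fun n => by
    rw [comp_apply, hD, hW, map_smul]
    exact congrArg _ (hU n).symm
  have hDc := isCompactOperator_diagonal h hD hw
  refine ⟨?_, ?_⟩
  · rw [e]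
    exact hDc.clm_comp U.toContinuousLinearMap
  · rw [e, adjoint_comp, adjoint_diagonal h hD]
    exact hDc.comp_clm _

end WeightedShift

/-! ### The oscillator's weights and the near-idempotence of `Q`. -/

section Oscillator

open Topology ContinuousLinearMap

/-- The eigenvalues of `Δ⁻¹` for the oscillator whose ladder operator `C` acts by
`h_n ↦ √(ε(n+1)) h_{n+1}`. -/
def invWeight (ε : ℝ) (n : ℕ) : ℝ := 1 / (1 + ε * (n + 1))

/-- The weights of `CΔ⁻¹`. -/
def ladderWeight (ε : ℝ) (n : ℕ) : ℝ := √(ε * (n + 1)) / (1 + ε * (n + 1))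

/-- The weights of `C(C*C)⁻¹`. -/
def graphWeight (ε : ℝ) (n : ℕ) : ℝ := 1 / √(ε * (n + 1))

/-- The eigenvalues of `(1 + CC*)⁻¹`. -/
def coinvWeight (ε : ℝ) : ℕ → ℝ
  | 0 => 1
  | n + 1 => invWeight ε n

section Weights

variable {ε : ℝ}

theorem level_pos (hε : 0 < ε) (n : ℕ) : 0 < ε * ((n : ℝ) + 1) := by positivity

theorem invWeight_nonneg (hε : 0 < ε) (n : ℕ) : 0 ≤ invWeight ε n := by
  have := level_pos hε n
  unfold invWeight; positivity

theorem invWeight_le_one (hε : 0 < ε) (n : ℕ) : invWeight ε n ≤ 1 := by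
  have := level_pos hε n
  rw [invWeight, div_le_one (by positivity)]; linarith

theorem abs_invWeight_le (hε : 0 < ε) (n : ℕ) : |invWeight ε n| ≤ 1 := by
  rw [abs_of_nonneg (invWeight_nonneg hε n)]; exact invWeight_le_one hε n

theorem abs_coinvWeight_le (hε : 0 < ε) (n : ℕ) : |coinvWeight ε n| ≤ 1 := by
  cases n with
  | zero => simp [coinvWeight]
  | succ n => exact abs_invWeight_le hε n

theorem abs_ladderWeight_le (hε : 0 < ε) (n : ℕ) : |ladderWeight ε n| ≤ 1 := by
  have := level_pos hε n
  rw [ladderWeight, abs_of_nonneg (by positivity), div_le_one (by positivity)]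
  have h1 := Real.sq_sqrt this.le
  nlinarith [Real.sqrt_nonneg (ε * ((n : ℝ) + 1)), sq_nonneg (√(ε * ((n : ℝ) + 1)) - 1)]

theorem abs_graphWeight_le (hε : 0 < ε) (n : ℕ) : |graphWeight ε n| ≤ 1 / √ε := by
  have := level_pos hε n
  rw [graphWeight, abs_of_nonneg (by positivity)]
  refine one_div_le_one_div_of_le (Real.sqrt_pos.mpr hε) (Real.sqrt_le_sqrt ?_)
  nlinarith [(n.cast_nonneg : (0 : ℝ) ≤ n)]

theorem tendsto_level (hε : 0 < ε) : Tendsto (fun n : ℕ => ε * ((n : ℝ) + 1)) atTop atTop :=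
  (tendsto_atTop_add_const_right _ _ tendsto_natCast_atTop_atTop).const_mul_atTop hε

theorem tendsto_invWeight (hε : 0 < ε) : Tendsto (invWeight ε) atTop (𝓝 0) := by
  change Tendsto (fun n : ℕ => 1 / (1 + ε * ((n : ℝ) + 1))) atTop (𝓝 0)
  simp only [one_div]
  exact tendsto_inv_atTop_zero.comp (tendsto_atTop_add_const_left _ _ (tendsto_level hε))

theorem tendsto_graphWeight (hε : 0 < ε) : Tendsto (graphWeight ε) atTop (𝓝 0) := by
  change Tendsto (fun n : ℕ => 1 / √(ε * ((n : ℝ) + 1))) atTop (𝓝 0)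
  simp only [one_div]
  exact tendsto_inv_atTop_zero.comp (Real.tendsto_sqrt_atTop.comp (tendsto_level hε))

/-- The scalar form of `T'R + S = R`, where `R = C(C*C)⁻¹`: together with the next identity it puts
`(Rv, v)` in the range of the exact projection. -/
theorem graphWeight_mul_invWeight_add (hε : 0 < ε) (n : ℕ) :
    invWeight ε n * graphWeight ε n + ladderWeight ε n =
    graphWeight ε n := by
  have h0 := level_pos hε n
  have h1 := Real.sq_sqrt h0.le
  have h2 := Real.sqrt_pos.mpr h0
  unfold invWeight graphWeight ladderWeight
  set r := √(ε * ((n : ℝ) + 1))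
  rw [← h1]
  field_simp

/-- The scalar form of `S*R = T`; it also gives `SR* = T'` on the vectors `h (n + 1)`. -/
theorem ladderWeight_mul_graphWeight (hε : 0 < ε) (n : ℕ) :
    ladderWeight ε n * graphWeight ε n = invWeight ε n := by
  have h0 := level_pos hε n
  have h1 := Real.sq_sqrt h0.le
  have h2 := Real.sqrt_pos.mpr h0
  unfold invWeight graphWeight ladderWeight
  set r := √(ε * ((n : ℝ) + 1))
  rw [← h1]
  field_simp

/-- The scalar form of `S*S = T - T²`. -/
theorem ladderWeight_sq (hε : 0 < ε) (n : ℕ) : ladderWeight ε n * ladderWeight ε n =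
    invWeight ε n - invWeight ε n * invWeight ε n := by
  have h0 := level_pos hε n
  have h1 := Real.sq_sqrt h0.le
  unfold invWeight ladderWeight
  set r := √(ε * ((n : ℝ) + 1))
  rw [← h1]
  field_simp
  ring

theorem ladderWeight_le_graphWeight (hε : 0 < ε) (n : ℕ) : ladderWeight ε n ≤ graphWeight ε n := by
  rw [← graphWeight_mul_invWeight_add hε n]
  have h1 := invWeight_nonneg hε n
  have h2 : 0 ≤ graphWeight ε n := by unfold graphWeight; positivity
  nlinarith [mul_nonneg h1 h2]

theorem tendsto_ladderWeight (hε : 0 < ε) : Tendsto (ladderWeight ε) atTop (𝓝 0) := by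
  refine squeeze_zero (fun n => ?_) (ladderWeight_le_graphWeight hε) (tendsto_graphWeight hε)
  have := level_pos hε n
  unfold ladderWeight; positivity

/-- The two sequences are the eigenvalues of `(1 + C*C)⁻¹` and `(1 + CC*)⁻¹`, and `C*C - CC* = ε` on
the basis. The resolvent identity writes the difference as `-ε` times a product of two resolvents of
norm at most one. -/
theorem abs_invWeight_sub_coinvWeight_le (hε : 0 < ε) (n : ℕ) :
    |invWeight ε n - coinvWeight ε n| ≤ ε := by
  cases n with
  | zero =>
    simp only [invWeight, coinvWeight, Nat.cast_zero, zero_add, mul_one]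
    rw [abs_le]
    constructor
    · rw [le_sub_iff_add_le, le_div_iff₀ (by positivity)]; nlinarith
    · have : 1 / (1 + ε) ≤ 1 := by rw [div_le_one (by positivity)]; linarith
      linarith
  | succ n =>
    have h0 := level_pos hε n
    have h1 : invWeight ε (n + 1) - coinvWeight ε (n + 1) =
        -(ε * (invWeight ε n * invWeight ε (n + 1))) := by
      have h2 := level_pos hε (n + 1)
      simp only [coinvWeight, invWeight]
      push_cast at h2 ⊢
      field_simp
      ring
    rw [h1, abs_neg, abs_of_nonneg (mul_nonneg hε.le
      (mul_nonneg (invWeight_nonneg hε _) (invWeight_nonneg hε _)))]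
    exact mul_le_of_le_one_right hε.le
      (mul_le_one₀ (invWeight_le_one hε _) (invWeight_nonneg hε _) (invWeight_le_one hε _))

end Weights

variable {H : Type*} [NormedAddCommGroup H] [InnerProductSpace ℂ H] [CompleteSpace H]
  {h : HilbertBasis ℕ ℂ H} {ε : ℝ} {T S : H →L[ℂ] H}

theorem inner_blockOp_symm {a b d : H →L[ℂ] H} (ha : adjoint a = a) (hd : adjoint d = d)
    (x y : WithLp 2 (H × H)) :
    ⟪blockOp a b (adjoint b) d x, y⟫_ℂ = ⟪x, blockOp a b (adjoint b) d y⟫_ℂ := by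
  obtain ⟨x₁, x₂, rfl⟩ : ∃ x₁ x₂, x = WithLp.toLp 2 (x₁, x₂) := ⟨x.fst, x.snd, rfl⟩
  obtain ⟨y₁, y₂, rfl⟩ : ∃ y₁ y₂, y = WithLp.toLp 2 (y₁, y₂) := ⟨y.fst, y.snd, rfl⟩
  rw [blockOp_apply, blockOp_apply, WithLp.prod_inner_apply, WithLp.prod_inner_apply]
  have h1 : ⟪a x₁, y₁⟫_ℂ = ⟪x₁, a y₁⟫_ℂ := by rw [← adjoint_inner_right, ha]
  have h2 : ⟪d x₂, y₂⟫_ℂ = ⟪x₂, d y₂⟫_ℂ := by rw [← adjoint_inner_right, hd]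
  simp only [inner_add_left, inner_add_right, h1, h2, adjoint_inner_left, adjoint_inner_right]
  rw [← adjoint_inner_right b x₂ y₁]
  ring

/-- The operator `Q` of the oscillator is nearly idempotent. -/
theorem norm_oscillator_sq_sub_lt (hε : 0 < ε) (hε' : ε ≤ 1 / 50)
    (hT : ∀ n, T (h n) = (invWeight ε n : ℂ) • h n)
    (hS : ∀ n, S (h n) = (ladderWeight ε n : ℂ) • h (n + 1)) :
    ‖blockOp T S (adjoint S) (1 - T) * blockOp T S (adjoint S) (1 - T) -
      blockOp T S (adjoint S) (1 - T)‖ < 1 / 4 := by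
  obtain ⟨T', hT'⟩ := exists_diagonal h (coinvWeight ε) (abs_coinvWeight_le hε)
  have hTT' : ∀ n, (T - T') (h n) = ((invWeight ε n - coinvWeight ε n : ℝ) : ℂ) • h n := by
    intro n
    rw [sub_apply, hT, hT', ← sub_smul]; push_cast; rfl
  have hE := norm_diagonal_le h hTT' hε.le (abs_invWeight_sub_coinvWeight_le hε)
  have hT'n := norm_diagonal_le h hT' zero_le_one (abs_coinvWeight_le hε)
  have hSn := norm_weightedShift_le h hS zero_le_one (abs_ladderWeight_le hε)
  set E := T - T' with hEdef
  have hTE : T = T' + E := by rw [hEdef]; abel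
  have hS0 := adjoint_weightedShift_zero h hS
  have hS1 := adjoint_weightedShift_succ h hS
  -- The identities `g1` to `g4` are the four block entries of `P² = P` for `P = blockOp T' S
  -- (adjoint S) (1 - T)`.
  have g1 : T' ∘L T' + S ∘L adjoint S = T' := hilbertBasis_clm_ext h fun n => by
    cases n with
    | zero => simp [hT', hS0, coinvWeight]
    | succ n =>
      simp only [add_apply, comp_apply, hT', hS1, hS, map_smul, smul_smul, ← add_smul, coinvWeight,
        ← Complex.ofReal_mul, ← Complex.ofReal_add, ladderWeight_sq hε]
      congr 2
      ring
  have g2 : T' ∘L S = S ∘L T := hilbertBasis_clm_ext h fun n => by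
    simp only [comp_apply, hT', hS, hT, map_smul, smul_smul, coinvWeight, ← Complex.ofReal_mul,
      mul_comm]
  have g3 : adjoint S ∘L T' = T ∘L adjoint S := hilbertBasis_clm_ext h fun n => by
    cases n with
    | zero => simp [hT', hS0, coinvWeight]
    | succ n =>
      simp only [comp_apply, hT', hS1, hT, map_smul, smul_smul, coinvWeight, ← Complex.ofReal_mul,
        mul_comm]
  have g4 : adjoint S ∘L S = T - T ∘L T := hilbertBasis_clm_ext h fun n => by
    simp only [comp_apply, sub_apply, hS, hS1, hT, map_smul, smul_smul, ← sub_smul,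
      ← Complex.ofReal_mul, ← Complex.ofReal_sub, ladderWeight_sq hε]
  -- Since `Q = P + (E ⊕ 0)` and `P² = P`, the difference `Q² - Q` is `PE + EP + E² - E` with `E`
  -- read as `E ⊕ 0`.
  have key : blockOp T S (adjoint S) (1 - T) * blockOp T S (adjoint S) (1 - T) -
      blockOp T S (adjoint S) (1 - T) =
      blockOp (T' ∘L E + E ∘L T' + E ∘L E - E) (E ∘L S) (adjoint S ∘L E) 0 := by
    ext1 w
    obtain ⟨x, y, rfl⟩ : ∃ x y, w = WithLp.toLp 2 (x, y) := ⟨w.fst, w.snd, rfl⟩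
    have g1x := congrArg (fun f => f x) g1
    have g2y := congrArg (fun f => f y) g2
    have g3x := congrArg (fun f => f x) g3
    have g4y := congrArg (fun f => f y) g4
    simp only [add_apply, comp_apply, sub_apply] at g1x g2y g3x g4y
    simp only [sub_apply, mul_def, comp_apply, blockOp_apply, ← WithLp.toLp_sub, Prod.mk_sub_mk]
    congr 2
    · simp only [add_apply, comp_apply, one_apply_eq_self, map_add, map_sub, ← g2y]
      rw [hTE]
      simp only [add_apply, map_add]
      rw [eq_sub_of_add_eq' g1x]
      abel
    · simp only [one_apply_eq_self, map_add, map_sub, g4y, zero_apply, add_zero, ← g3x]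
      nth_rw 1 [hTE]
      simp only [add_apply, map_add]
      abel
  rw [key]
  refine (norm_blockOp_le _ _ _ _).trans_lt ?_
  have b1 : ‖T' ∘L E + E ∘L T' + E ∘L E - E‖ ≤ 1 * ε + ε * 1 + ε * ε + ε := by
    refine (norm_sub_le _ _).trans (add_le_add (norm_add₃_le.trans ?_) hE)
    gcongr
    · exact (opNorm_comp_le _ _).trans (by gcongr)
    · exact (opNorm_comp_le _ _).trans (by gcongr)
    · exact (opNorm_comp_le _ _).trans (by gcongr)
  have b2 : ‖E ∘L S‖ ≤ ε * 1 := (opNorm_comp_le _ _).trans (by gcongr)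
  have b3 : ‖adjoint S ∘L E‖ ≤ 1 * ε := (opNorm_comp_le _ _).trans (by
    rw [LinearIsometryEquiv.norm_map]; gcongr)
  rw [norm_zero]
  -- The block norms add up to at most `5ε + ε²`, which is below `1/4` for `ε ≤ 1/50`.
  nlinarith

end Oscillator

/-! ### Exactly `N + 1` eigenvalues of a large corner exceed `1/2`. -/

section Count

open Topology ContinuousLinearMap

section PartialSum

variable {H : Type*} [NormedAddCommGroup H] [InnerProductSpace ℂ H]

/-- The element of `H` with coordinates `x` in the first `N` basis vectors. -/
def partialSum (e : HilbertBasis ℕ ℂ H) (N : ℕ) : (Fin N → ℂ) →ₗ[ℂ] H :=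
  Fintype.linearCombination ℂ fun i : Fin N => e i

theorem partialSum_eq_zero (e : HilbertBasis ℕ ℂ H) (N : ℕ) {x : Fin N → ℂ}
    (hx : partialSum e N x = 0) : x = 0 := by
  have hli : LinearIndependent ℂ fun i : Fin N => e i :=
    (e.orthonormal.comp _ Fin.val_injective).linearIndependent
  funext i
  exact Fintype.linearIndependent_iff.mp hli x hx i

theorem trunc_partialSum (e : HilbertBasis ℕ ℂ H) (N : ℕ) (x : Fin N → ℂ) :
    trunc e N (partialSum e N x) = partialSum e N x := by
  simp only [partialSum, Fintype.linearCombination_apply, map_sum, map_smul, trunc_basis,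
    Fin.is_lt, if_true]

theorem re_inner_sub_half (Q : WithLp 2 (H × H) →L[ℂ] WithLp 2 (H × H)) (w : WithLp 2 (H × H)) :
    (⟪w, (Q - (1 / 2 : ℂ) • 1) w⟫_ℂ).re = (⟪w, Q w⟫_ℂ).re - 1 / 2 * ‖w‖ ^ 2 := by
  rw [sub_apply, smul_apply, one_apply_eq_self, inner_sub_right, inner_smul_right,
    inner_self_eq_norm_sq_to_K, Complex.sub_re]
  congr 1
  have : (1 / 2 : ℂ) * ((‖w‖ : ℝ) : ℂ) ^ 2 = ((1 / 2 * ‖w‖ ^ 2 : ℝ) : ℂ) := by push_cast; rfl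
  exact (congrArg Complex.re this).trans (Complex.ofReal_re _)

end PartialSum

variable {H : Type*} [NormedAddCommGroup H] [InnerProductSpace ℂ H] [CompleteSpace H]

theorem inner_toEuclideanCLM_corner (Q : WithLp 2 (H × H) →L[ℂ] WithLp 2 (H × H))
    (e : HilbertBasis ℕ ℂ H) (N : ℕ) (y : EuclideanSpace ℂ (Fin N ⊕ Fin N)) :
    ⟪y, Matrix.toEuclideanCLM (𝕜 := ℂ) (corner Q e N) y⟫_ℂ =
      ⟪cornerEmb e N y, Q (cornerEmb e N y)⟫_ℂ := by
  rw [toEuclideanCLM_corner, comp_apply, comp_apply, adjoint_inner_right]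

/-- The form of `q₁₁` at `J*w` is the form of `Q` at `JJ*w`. Hence test vectors `w` need only be
close to `L_N ⊕ L_N`, not inside it. -/
theorem abs_corner_form_sub_le (Q : WithLp 2 (H × H) →L[ℂ] WithLp 2 (H × H))
    (e : HilbertBasis ℕ ℂ H) (N : ℕ) {w : WithLp 2 (H × H)} {η : ℝ} (hη : η ≤ 1)
    (hw : ‖cornerEmb e N (adjoint (cornerEmb e N) w) - w‖ ≤ η * ‖w‖) :
    |((⟪adjoint (cornerEmb e N) w, Matrix.toEuclideanCLM (𝕜 := ℂ) (corner Q e N)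
        (adjoint (cornerEmb e N) w)⟫_ℂ).re - 1 / 2 * ‖adjoint (cornerEmb e N) w‖ ^ 2) -
      ((⟪w, Q w⟫_ℂ).re - 1 / 2 * ‖w‖ ^ 2)| ≤
      3 * η * ‖Q - (1 / 2 : ℂ) • 1‖ * ‖w‖ ^ 2 := by
  have h1 := abs_re_inner_sub_le (Q - (1 / 2 : ℂ) • 1) hη hw
  rwa [re_inner_sub_half, re_inner_sub_half, norm_cornerEmb, ← inner_toEuclideanCLM_corner] at h1

variable {h : HilbertBasis ℕ ℂ H} {ε : ℝ} {T S : H →L[ℂ] H}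

/-- For the oscillator, all large corners have exactly `N + 1` eigenvalues greater than `1/2`. -/
theorem eventually_card_eigenvalues (hε : 0 < ε) (hε' : ε ≤ 1 / 50)
    (hT : ∀ n, T (h n) = (invWeight ε n : ℂ) • h n)
    (hS : ∀ n, S (h n) = (ladderWeight ε n : ℂ) • h (n + 1)) (e : HilbertBasis ℕ ℂ H) :
    ∀ᶠ N : ℕ in atTop,
      ∀ hq : (corner (blockOp T S (adjoint S) (1 - T)) e N).IsHermitian,
        ((Finset.univ.filter fun i => 1 / 2 < hq.eigenvalues i).card : ℤ) - N = 1 := by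
  set Q := blockOp T S (adjoint S) (1 - T) with hQ
  obtain ⟨T', hT'⟩ := exists_diagonal h (coinvWeight ε) (abs_coinvWeight_le hε)
  have hTT' : ∀ n, (T - T') (h n) = ((invWeight ε n - coinvWeight ε n : ℝ) : ℂ) • h n := by
    intro n
    rw [sub_apply, hT, hT', ← sub_smul]; push_cast; rfl
  have hE := norm_diagonal_le h hTT' hε.le (abs_invWeight_sub_coinvWeight_le hε)
  -- `R = C(C*C)⁻¹` parametrises the graph of `C*` by its second coordinate, up to the kernel line
  -- spanned by `h 0`.
  obtain ⟨R, hR⟩ := exists_weightedShift h (graphWeight ε) (abs_graphWeight_le hε)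
  have hS0 := adjoint_weightedShift_zero h hS
  have hS1 := adjoint_weightedShift_succ h hS
  have hR0 := adjoint_weightedShift_zero h hR
  have hR1 := adjoint_weightedShift_succ h hR
  obtain ⟨hRc, hRc'⟩ := isCompactOperator_weightedShift h hR (abs_graphWeight_le hε)
    (tendsto_graphWeight hε)
  -- `p1` and `p2` say that the exact projection fixes `(Rv, v)`.
  have p1 : T' ∘L R + S = R := hilbertBasis_clm_ext h fun n => by
    simp only [add_apply, comp_apply, hT', hS, hR, map_smul, smul_smul, ← add_smul, coinvWeight,
      ← Complex.ofReal_mul, ← Complex.ofReal_add]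
    rw [mul_comm, graphWeight_mul_invWeight_add hε]
  have p2 : adjoint S ∘L R = T := hilbertBasis_clm_ext h fun n => by
    simp only [comp_apply, hS1, hR, hT, map_smul, smul_smul, ← Complex.ofReal_mul]
    rw [mul_comm, ladderWeight_mul_graphWeight hε]
  -- `n1` and `n2` say that the exact projection kills `(u, -R*u)` when `u ⊥ h 0`.
  have n1 : T' - S ∘L adjoint R = (innerSL ℂ (h 0)).smulRight (h 0) :=
    hilbertBasis_clm_ext h fun n => by
      cases n with
      | zero =>
        simp [hT', hR0, coinvWeight, h.orthonormal.1]
      | succ n =>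
        simp only [sub_apply, comp_apply, hT', hR1, hS, map_smul, smul_smul, coinvWeight,
          ← Complex.ofReal_mul, smulRight_apply, innerSL_apply_apply]
        rw [h.orthonormal.2 (Nat.succ_ne_zero n).symm, zero_smul, mul_comm,
          ladderWeight_mul_graphWeight hε, sub_self]
  have n2 : adjoint S = (1 - T) ∘L adjoint R := hilbertBasis_clm_ext h fun n => by
    cases n with
    | zero => simp [hS0, hR0]
    | succ n =>
      have hc : ladderWeight ε n = graphWeight ε n * (1 - invWeight ε n) := by
        linear_combination graphWeight_mul_invWeight_add hε n
      simp only [sub_apply, comp_apply, hS1, hR1, hT, map_smul, one_apply_eq_self, hc]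
      push_cast
      module
  have hEform : ∀ a b : H, |(⟪WithLp.toLp 2 (a, b), WithLp.toLp 2 ((T - T') a, (0 : H))⟫_ℂ).re| ≤
      ε * ‖WithLp.toLp 2 (a, b)‖ ^ 2 := by
    intro a b
    refine (Complex.abs_re_le_norm _).trans ((norm_inner_le_norm _ _).trans ?_)
    have h1 : ‖WithLp.toLp 2 ((T - T') a, (0 : H))‖ ≤ ε * ‖WithLp.toLp 2 (a, b)‖ := by
      refine (norm_toLp_prod_le _ _).trans ?_
      rw [norm_zero, add_zero]
      refine ((T - T').le_of_opNorm_le hE a).trans ?_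
      gcongr
      exact norm_fst_le_toLp a b
    nlinarith [norm_nonneg (WithLp.toLp 2 (a, b))]
  -- On the range of the exact projection `Q` is the identity up to `E`, so its form is at least `1
  -- - ε` times the squared norm; `3/4` leaves room for truncation. Symmetrically, `1/4` below
  -- bounds the form on the kernel.
  have hpos : ∀ (α : ℂ) (v : H), 3 / 4 * ‖WithLp.toLp 2 (α • h 0 + R v, v)‖ ^ 2 ≤
      (⟪WithLp.toLp 2 (α • h 0 + R v, v), Q (WithLp.toLp 2 (α • h 0 + R v, v))⟫_ℂ).re := by
    intro α v
    have hb := hEform (α • h 0 + R v) v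
    set w := WithLp.toLp 2 (α • h 0 + R v, v) with hw
    have e1 : Q w = w + WithLp.toLp 2 ((T - T') (α • h 0 + R v), (0 : H)) := by
      rw [hw, hQ, blockOp_apply, ← WithLp.toLp_add, Prod.mk_add_mk]
      have q1 := congrArg (fun f => f v) p1
      have q2 := congrArg (fun f => f v) p2
      simp only [add_apply, comp_apply] at q1 q2
      have q3 : T' (h 0) = h 0 := by simp [hT', coinvWeight]
      congr 2
      · simp only [sub_apply, map_add, map_smul, q3, smul_sub]
        nth_rw 2 [← q1]
        abel
      · simp only [map_add, map_smul, hS0, q2, sub_apply, one_apply_eq_self, smul_zero]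
        abel
    rw [e1, inner_add_right, Complex.add_re, inner_self_eq_norm_sq_to_K]
    have e2 : (((‖w‖ : ℝ) : ℂ) ^ 2).re = ‖w‖ ^ 2 := by
      rw [← Complex.ofReal_pow, Complex.ofReal_re]
    have e3 := (abs_le.mp hb).1
    have e4 : ε * ‖w‖ ^ 2 ≤ 1 / 50 * ‖w‖ ^ 2 := by gcongr
    have e5 : 3 / 4 * ‖w‖ ^ 2 ≤ (((‖w‖ : ℝ) : ℂ) ^ 2).re +
        (⟪w, WithLp.toLp 2 ((T - T') (α • h 0 + R v), (0 : H))⟫_ℂ).re := by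
      rw [e2]
      nlinarith [sq_nonneg ‖w‖]
    exact e5
  have hneg : ∀ u : H, ⟪h 0, u⟫_ℂ = 0 →
      (⟪WithLp.toLp 2 (u, -adjoint R u), Q (WithLp.toLp 2 (u, -adjoint R u))⟫_ℂ).re ≤
        1 / 4 * ‖WithLp.toLp 2 (u, -adjoint R u)‖ ^ 2 := by
    intro u hu
    have hb := hEform u (-adjoint R u)
    set w := WithLp.toLp 2 (u, -adjoint R u) with hw
    have e1 : Q w = WithLp.toLp 2 ((T - T') u, (0 : H)) := by
      rw [hw, hQ, blockOp_apply]
      have q1 := congrArg (fun f => f u) n1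
      have q2 := congrArg (fun f => f u) n2
      simp only [sub_apply, comp_apply, smulRight_apply, innerSL_apply_apply, hu, zero_smul,
        sub_eq_zero] at q1
      simp only [comp_apply] at q2
      congr 2
      · simp only [sub_apply, map_neg, ← q1]
        abel
      · rw [q2, map_neg, add_neg_cancel]
    rw [e1]
    have e3 := (abs_le.mp hb).2
    have e4 : ε * ‖w‖ ^ 2 ≤ 1 / 50 * ‖w‖ ^ 2 := by gcongr
    nlinarith [sq_nonneg ‖w‖]
  have hlim := ((tendsto_one_sub_trunc_apply e (h 0)).add (tendsto_one_sub_trunc_comp e hRc)).add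
    (tendsto_one_sub_trunc_comp e hRc')
  simp only [add_zero] at hlim
  -- The truncation error must fall below the margin `3/4 - 1/2 = 1/2 - 1/4`.
  have hlim' := (hlim.const_mul 3).mul_const ‖Q - (1 / 2 : ℂ) • 1‖
  simp only [mul_zero, zero_mul] at hlim'
  filter_upwards [hlim.eventually_lt_const (show (0 : ℝ) < 1 by norm_num),
    hlim'.eventually_lt_const (show (0 : ℝ) < 1 / 4 by norm_num)] with N hN1 hN2 hq
  set η := ‖(1 - trunc e N) (h 0)‖ + ‖(1 - trunc e N) ∘L R‖ + ‖(1 - trunc e N) ∘L adjoint R‖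
    with hη
  have hsmall : ∀ w : WithLp 2 (H × H), w ≠ 0 →
      3 * η * ‖Q - (1 / 2 : ℂ) • 1‖ * ‖w‖ ^ 2 < 1 / 4 * ‖w‖ ^ 2 := fun w hw => by
    have := norm_pos_iff.mpr hw
    gcongr
  have upper : N + 1 ≤ (Finset.univ.filter fun i => 1 / 2 < hq.eigenvalues i).card := by
    -- `(α, v) ↦ (α h_0 + Rv, v)` with `v ∈ L_N`: truncation alters only the first coordinate,
    -- through `h 0` and the compact `R`.
    let f₀ : (ℂ × (Fin N → ℂ)) →ₗ[ℂ] WithLp 2 (H × H) :=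
      (WithLp.linearEquiv 2 ℂ (H × H)).symm.toLinearMap ∘ₗ
        LinearMap.prod ((LinearMap.toSpanSingleton ℂ H (h 0)).coprod
          (R.toLinearMap ∘ₗ partialSum e N)) (partialSum e N ∘ₗ LinearMap.snd ℂ ℂ (Fin N → ℂ))
    have hf₀ : ∀ p, f₀ p = WithLp.toLp 2 (p.1 • h 0 + R (partialSum e N p.2),
      partialSum e N p.2) := fun p => rfl
    have := finrank_le_card_eigenvalues_gt hq (1 / 2)
      ((adjoint (cornerEmb e N)).toLinearMap ∘ₗ f₀) fun p hp => ?_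
    · simpa [add_comm] using this
    change 1 / 2 * ‖adjoint (cornerEmb e N) (f₀ p)‖ ^ 2 < (⟪adjoint (cornerEmb e N) (f₀ p),
      Matrix.toEuclideanCLM (𝕜 := ℂ) (corner Q e N) (adjoint (cornerEmb e N) (f₀ p))⟫_ℂ).re
    -- Since `R* h_0 = 0`, the scalar `α` is recovered by pairing the first coordinate with `h 0`.
    have hα : ‖p.1‖ ≤ ‖f₀ p‖ := by
      have h1 : ⟪h 0, p.1 • h 0 + R (partialSum e N p.2)⟫_ℂ = p.1 := by
        rw [inner_add_right, inner_smul_right, inner_self_eq_norm_sq_to_K, h.orthonormal.1,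
          ← adjoint_inner_left, hR0, inner_zero_left]
        simp
      have h2 := norm_inner_le_norm (𝕜 := ℂ) (h 0) (p.1 • h 0 + R (partialSum e N p.2))
      rw [h1, h.orthonormal.1, one_mul] at h2
      exact h2.trans (norm_fst_le_toLp _ _)
    have hv : ‖partialSum e N p.2‖ ≤ ‖f₀ p‖ := norm_snd_le_toLp _ _
    have hne : f₀ p ≠ 0 := by
      intro h0
      rw [h0, norm_zero] at hα hv
      exact hp (Prod.ext (norm_le_zero_iff.mp hα) (partialSum_eq_zero e N (norm_le_zero_iff.mp hv)))
    have hclose : ‖cornerEmb e N (adjoint (cornerEmb e N) (f₀ p)) - f₀ p‖ ≤ η * ‖f₀ p‖ := by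
      set m := ‖f₀ p‖
      have e1 : cornerEmb e N (adjoint (cornerEmb e N) (f₀ p)) - f₀ p =
          -WithLp.toLp 2 (p.1 • (1 - trunc e N) (h 0) +
            ((1 - trunc e N) ∘L R) (partialSum e N p.2), (0 : H)) := by
        rw [hf₀, cornerEmb_adjoint_apply, trunc_partialSum, ← WithLp.toLp_sub, ← WithLp.toLp_neg,
          Prod.mk_sub_mk, Prod.neg_mk, sub_self, neg_zero]
        simp only [comp_apply, sub_apply, one_apply_eq_self, map_add, map_smul, smul_sub]
        congr 2
        abel
      rw [e1, norm_neg]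
      refine (norm_toLp_prod_le _ _).trans ?_
      rw [norm_zero, add_zero]
      refine (norm_add_le _ _).trans ?_
      rw [norm_smul]
      have b1 : ‖p.1‖ * ‖(1 - trunc e N) (h 0)‖ ≤ m * ‖(1 - trunc e N) (h 0)‖ := by gcongr
      have b2 : ‖((1 - trunc e N) ∘L R) (partialSum e N p.2)‖ ≤ ‖(1 - trunc e N) ∘L R‖ * m :=
        (le_opNorm _ _).trans (by gcongr)
      have b3 : 0 ≤ ‖(1 - trunc e N) ∘L adjoint R‖ * m := by positivity
      rw [hη]
      linarith
    have h1 := (abs_le.mp (abs_corner_form_sub_le Q e N hN1.le hclose)).1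
    have h2 := hsmall _ hne
    have h3 := hpos p.1 (partialSum e N p.2)
    rw [← hf₀] at h3
    linarith
  have lower : N - 1 ≤ (Finset.univ.filter fun i => ¬ 1 / 2 < hq.eigenvalues i).card := by
    -- The vector `h 0` need not lie in `L_N`, so the test space is the set of `u ∈ L_N` orthogonal
    -- to it: the kernel of one functional, of dimension at least `N - 1`.
    let ℓ : (Fin N → ℂ) →ₗ[ℂ] ℂ := (innerSL ℂ (h 0)).toLinearMap ∘ₗ partialSum e N
    have hker : N - 1 ≤ Module.finrank ℂ (LinearMap.ker ℓ) := by
      have h1 := LinearMap.finrank_range_add_finrank_ker ℓ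
      have h2 := Submodule.finrank_le (LinearMap.range ℓ)
      rw [Module.finrank_self] at h2
      rw [Module.finrank_fin_fun] at h1
      omega
    refine hker.trans ?_
    let g₀ : LinearMap.ker ℓ →ₗ[ℂ] WithLp 2 (H × H) :=
      (WithLp.linearEquiv 2 ℂ (H × H)).symm.toLinearMap ∘ₗ
        LinearMap.prod LinearMap.id (-(adjoint R).toLinearMap) ∘ₗ partialSum e N ∘ₗ
          (LinearMap.ker ℓ).subtype
    have hg₀ : ∀ p, g₀ p = WithLp.toLp 2 (partialSum e N p, -adjoint R (partialSum e N p)) :=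
      fun p => rfl
    refine finrank_le_card_eigenvalues_le hq (1 / 2)
      ((adjoint (cornerEmb e N)).toLinearMap ∘ₗ g₀) fun p hp => ?_
    change (⟪adjoint (cornerEmb e N) (g₀ p), Matrix.toEuclideanCLM (𝕜 := ℂ) (corner Q e N)
      (adjoint (cornerEmb e N) (g₀ p))⟫_ℂ).re < 1 / 2 * ‖adjoint (cornerEmb e N) (g₀ p)‖ ^ 2
    have hv : ‖partialSum e N p‖ ≤ ‖g₀ p‖ := norm_fst_le_toLp _ _
    have hne : g₀ p ≠ 0 := by
      intro h0
      rw [h0, norm_zero] at hv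
      exact hp (Subtype.ext (partialSum_eq_zero e N (norm_le_zero_iff.mp hv)))
    have hclose : ‖cornerEmb e N (adjoint (cornerEmb e N) (g₀ p)) - g₀ p‖ ≤ η * ‖g₀ p‖ := by
      set m := ‖g₀ p‖
      have e1 : cornerEmb e N (adjoint (cornerEmb e N) (g₀ p)) - g₀ p =
          WithLp.toLp 2 ((0 : H), ((1 - trunc e N) ∘L adjoint R) (partialSum e N p)) := by
        rw [hg₀, cornerEmb_adjoint_apply, trunc_partialSum, ← WithLp.toLp_sub,
          Prod.mk_sub_mk, sub_self]
        simp only [comp_apply, sub_apply, one_apply_eq_self, map_neg]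
        congr 2
        abel
      rw [e1]
      refine (norm_toLp_prod_le _ _).trans ?_
      rw [norm_zero, zero_add]
      have b2 : ‖((1 - trunc e N) ∘L adjoint R) (partialSum e N p)‖ ≤
          ‖(1 - trunc e N) ∘L adjoint R‖ * m := (le_opNorm _ _).trans (by gcongr)
      have b1 : 0 ≤ ‖(1 - trunc e N) (h 0)‖ * m := by positivity
      have b3 : 0 ≤ ‖(1 - trunc e N) ∘L R‖ * m := by positivity
      rw [hη]
      linarith
    have h1 := (abs_le.mp (abs_corner_form_sub_le Q e N hN1.le hclose)).2
    have h2 := hsmall _ hne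
    have h3 := hneg (partialSum e N p) p.2
    rw [← hg₀] at h3
    linarith
  have total := Finset.card_filter_add_card_filter_not (s := Finset.univ)
    fun i => 1 / 2 < hq.eigenvalues i
  rw [Finset.card_univ, Fintype.card_sum, Fintype.card_fin] at total
  -- For `N = 0` the natural subtraction `N - 1` truncates; there `upper` already contradicts
  -- `total`.
  rcases Nat.eq_zero_or_pos N with hN0 | hN0 <;> omega

end Count

/-! ### From ladder relations on a basis to the closed operator `C` and to `Δ⁻¹`. -/

section Ladder

open Topology ContinuousLinearMap

variable {H : Type*} [NormedAddCommGroup H] [InnerProductSpace ℂ H]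

/-- The pair `(A, B)` acts on the basis `h` as a harmonic oscillator: `A - iB` is the weighted shift
`h_n ↦ √(ε(n+1)) h_{n+1}`, and `A + iB` acts as its adjoint. -/
structure IsOscillator (A B : H →ₗ.[ℂ] H) (h : HilbertBasis ℕ ℂ H) (ε : ℝ) : Prop where
  symm_left : A.IsFormalAdjoint A
  symm_right : B.IsFormalAdjoint B
  mem_left : ∀ n, h n ∈ A.domain
  mem_right : ∀ n, h n ∈ B.domain
  raise : ∀ n, A ⟨h n, mem_left n⟩ - Complex.I • B ⟨h n, mem_right n⟩ =
    (√(ε * (n + 1)) : ℂ) • h (n + 1)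
  lower_zero : A ⟨h 0, mem_left 0⟩ + Complex.I • B ⟨h 0, mem_right 0⟩ = 0
  lower_succ : ∀ n, A ⟨h (n + 1), mem_left (n + 1)⟩ +
    Complex.I • B ⟨h (n + 1), mem_right (n + 1)⟩ = (√(ε * (n + 1)) : ℂ) • h n

namespace IsOscillator

variable {A B : H →ₗ.[ℂ] H} {h : HilbertBasis ℕ ℂ H} {ε : ℝ}

theorem dense_domain (hAB : IsOscillator A B h ε) :
    Dense ((A.domain ⊓ B.domain : Submodule ℂ H) : Set H) := by
  have h1 := h.dense_span
  rw [← Submodule.dense_iff_topologicalClosure_eq_top] at h1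
  refine h1.mono (Submodule.span_le.mpr ?_)
  rintro _ ⟨n, rfl⟩
  exact ⟨hAB.mem_left n, hAB.mem_right n⟩

/-- Places `A - iB` inside the closed operator `(A + iB)†`, which makes it closable and bounds its
closure from above. -/
theorem isFormalAdjoint (hAB : IsOscillator A B h ε) :
    (A + Complex.I • B).IsFormalAdjoint (A - Complex.I • B) := by
  rintro ⟨x, hxA, hxB⟩ ⟨y, hyA, hyB⟩
  change ⟪A ⟨x, hxA⟩ + Complex.I • B ⟨x, hxB⟩, y⟫_ℂ = ⟪x, A ⟨y, hyA⟩ - Complex.I • B ⟨y, hyB⟩⟫_ℂ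
  have e1 : ⟪A ⟨x, hxA⟩, y⟫_ℂ = ⟪x, A ⟨y, hyA⟩⟫_ℂ := hAB.symm_left ⟨x, hxA⟩ ⟨y, hyA⟩
  have e2 : ⟪B ⟨x, hxB⟩, y⟫_ℂ = ⟪x, B ⟨y, hyB⟩⟫_ℂ := hAB.symm_right ⟨x, hxB⟩ ⟨y, hyB⟩
  rw [inner_add_left, inner_sub_right, inner_smul_left, inner_smul_right, e1, e2, Complex.conj_I]
  ring

theorem mem_opC_graph (hAB : IsOscillator A B h ε) (n : ℕ) :
    (h n, (√(ε * (n + 1)) : ℂ) • h (n + 1)) ∈ (opC A B).graph := by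
  refine LinearPMap.le_graph_of_le (LinearPMap.le_closure (A - Complex.I • B)) ?_
  rw [← hAB.raise n]
  exact LinearPMap.mem_graph (A - Complex.I • B) ⟨h n, hAB.mem_left n, hAB.mem_right n⟩

theorem dense_opC_domain (hAB : IsOscillator A B h ε) : Dense ((opC A B).domain : Set H) :=
  hAB.dense_domain.mono (LinearPMap.le_closure (A - Complex.I • B)).1

variable [CompleteSpace H]

theorem le_adjoint (hAB : IsOscillator A B h ε) :
    A - Complex.I • B ≤ (A + Complex.I • B)† :=
  hAB.isFormalAdjoint.le_adjoint hAB.dense_domain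

theorem isClosable (hAB : IsOscillator A B h ε) : (A - Complex.I • B).IsClosable :=
  (LinearPMap.adjoint_isClosed (T := A + Complex.I • B) hAB.dense_domain).isClosable.leIsClosable
    hAB.le_adjoint

theorem opC_le_adjoint (hAB : IsOscillator A B h ε) : opC A B ≤ (A + Complex.I • B)† := by
  refine LinearPMap.le_of_le_graph ?_
  rw [opC, ← hAB.isClosable.graph_closure_eq_closure_graph]
  exact Submodule.topologicalClosure_minimal _ (LinearPMap.le_graph_of_le hAB.le_adjoint)
    (LinearPMap.adjoint_isClosed (T := A + Complex.I • B) hAB.dense_domain)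

theorem inner_opC (hAB : IsOscillator A B h ε) (x : (opC A B).domain)
    (y : (A + Complex.I • B).domain) :
    ⟪opC A B x, y⟫_ℂ = ⟪(x : H), (A + Complex.I • B) y⟫_ℂ := by
  have h1 := LinearPMap.adjoint_isFormalAdjoint (T := A + Complex.I • B) hAB.dense_domain
    ⟨x, hAB.opC_le_adjoint.1 x.2⟩ y
  rwa [← hAB.opC_le_adjoint.2 (x := x) (y := ⟨x, hAB.opC_le_adjoint.1 x.2⟩) rfl] at h1

/-- Every `h (n + 1)` lies in the domain of `A + iB`, and the closure stays inside `(A + iB)†`. So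
its coefficients are known on its whole domain, not only on the span of the basis. -/
theorem inner_basis_succ_opC (hAB : IsOscillator A B h ε) (x : (opC A B).domain) (n : ℕ) :
    ⟪h (n + 1), opC A B x⟫_ℂ = √(ε * (n + 1)) * ⟪h n, x⟫_ℂ := by
  have h1 := hAB.inner_opC x ⟨h (n + 1), hAB.mem_left (n + 1), hAB.mem_right (n + 1)⟩
  have h2 : (A + Complex.I • B) ⟨h (n + 1), hAB.mem_left (n + 1), hAB.mem_right (n + 1)⟩ =
    (√(ε * (n + 1)) : ℂ) • h n := hAB.lower_succ n
  rw [h2, inner_smul_right] at h1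
  rw [← inner_conj_symm, h1, map_mul, Complex.conj_ofReal, inner_conj_symm]

variable {T S : H →L[ℂ] H}

/-- True on basis vectors, hence everywhere: `x ↦ (T x, S x)` is continuous and the graph of `C` is
closed. -/
theorem mem_opC_graph_inverse (hAB : IsOscillator A B h ε)
    (hT : ∀ n, T (h n) = (invWeight ε n : ℂ) • h n)
    (hS : ∀ n, S (h n) = (ladderWeight ε n : ℂ) • h (n + 1))
    (x : H) :
    (T x, S x) ∈ (opC A B).graph := by
  have hcl : IsClosed ((opC A B).graph : Set (H × H)) := hAB.isClosable.closure_isClosed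
  have hsub : (Submodule.span ℂ (Set.range h)).topologicalClosure ≤
      (opC A B).graph.comap (T.prod S : H →L[ℂ] H × H).toLinearMap := by
    refine Submodule.topologicalClosure_minimal _ (Submodule.span_le.mpr ?_)
      (hcl.preimage (T.prod S).continuous)
    rintro _ ⟨n, rfl⟩
    change (T (h n), S (h n)) ∈ (opC A B).graph
    have h1 := (opC A B).graph.smul_mem (invWeight ε n : ℂ) (hAB.mem_opC_graph n)
    rw [Prod.smul_mk, smul_smul] at h1
    convert h1 using 2
    · exact hT n
    · rw [hS n, ladderWeight, invWeight, ← Complex.ofReal_mul]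
      congr 2
      ring
  rw [h.dense_span] at hsub
  exact hsub (Submodule.mem_top (x := x))

theorem exists_opC_eq (hAB : IsOscillator A B h ε)
    (hT : ∀ n, T (h n) = (invWeight ε n : ℂ) • h n)
    (hS : ∀ n, S (h n) = (ladderWeight ε n : ℂ) • h (n + 1))
    (x : H) :
    ∃ hx : T x ∈ (opC A B).domain, S x = opC A B ⟨T x, hx⟩ := by
  obtain ⟨y, hy1, hy2⟩ := (LinearPMap.mem_graph_iff _).mp (hAB.mem_opC_graph_inverse hT hS x)
  obtain ⟨y, hy⟩ := y
  simp only at hy1 hy2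
  subst hy1
  exact ⟨hy, hy2.symm⟩

/-- The identity `S*C = 1 - T` on the domain of `C`, checked coefficientwise. It shows that `S x`
lies in the domain of `C*`, with `C*S x = x - T x`. -/
theorem inner_ladder_opC (hAB : IsOscillator A B h ε) (hε : 0 < ε)
    (hT : ∀ n, T (h n) = (invWeight ε n : ℂ) • h n)
    (hS : ∀ n, S (h n) = (ladderWeight ε n : ℂ) • h (n + 1))
    (x : H) (u : (opC A B).domain) :
    ⟪S x, opC A B u⟫_ℂ = ⟪x - T x, u⟫_ℂ := by
  have e1 : adjoint S (opC A B u) = (1 - T) u := by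
    refine hilbertBasis_ext h fun n => ?_
    rw [adjoint_inner_right, hS, inner_smul_left, hAB.inner_basis_succ_opC, Complex.conj_ofReal,
      sub_apply, inner_sub_right, inner_basis_diagonal h hT, one_apply_eq_self, ← mul_assoc,
      ← Complex.ofReal_mul]
    have : ladderWeight ε n * √(ε * (n + 1)) = 1 - invWeight ε n := by
      have h0 := level_pos hε n
      have h1 := Real.sq_sqrt h0.le
      unfold ladderWeight invWeight
      set r := √(ε * ((n : ℝ) + 1))
      rw [← h1]
      field_simp
      ring
    rw [this]
    push_cast
    ring
  have e2 : ⟪T x, (u : H)⟫_ℂ = ⟪x, T u⟫_ℂ := by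
    rw [← adjoint_inner_right, adjoint_diagonal h hT]
  rw [← adjoint_inner_right, e1, sub_apply, one_apply_eq_self, inner_sub_right, inner_sub_left, e2]

theorem isBoundedInverse (hAB : IsOscillator A B h ε) (hε : 0 < ε)
    (hT : ∀ n, T (h n) = (invWeight ε n : ℂ) • h n)
    (hS : ∀ n, S (h n) = (ladderWeight ε n : ℂ) • h (n + 1)) : IsBoundedInverse (delta A B) T := by
  constructor
  · intro x
    obtain ⟨hx, hSx⟩ := hAB.exists_opC_eq hT hS x
    have hadj : ∀ u : (opC A B).domain, ⟪x - T x, (u : H)⟫_ℂ = ⟪opC A B ⟨T x, hx⟩, opC A B u⟫_ℂ :=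
      fun u => by rw [← hSx, hAB.inner_ladder_opC hε hT hS]
    have hmem : opC A B ⟨T x, hx⟩ ∈ (opC A B)†.domain :=
      LinearPMap.mem_adjoint_domain_of_exists _ ⟨x - T x, hadj⟩
    refine ⟨⟨hx, hmem⟩, ?_⟩
    change T x + (opC A B)† ⟨opC A B ⟨T x, hx⟩, hmem⟩ = x
    rw [LinearPMap.adjoint_apply_eq hAB.dense_opC_domain _ hadj]
    abel
  -- For the left inverse, moving `C*` onto the basis shows that `C*C y` has coefficients `ε(n+1)⟪h
  -- n, y⟫`, which `T` undoes.
  · rintro ⟨y, hy, hy'⟩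
    change T (y + (opC A B)† ⟨opC A B ⟨y, hy⟩, hy'⟩) = y
    refine hilbertBasis_ext h fun n => ?_
    obtain ⟨u, hu1, hu2⟩ := (LinearPMap.mem_graph_iff _).mp (hAB.mem_opC_graph n)
    simp only at hu1 hu2
    have h1 := (LinearPMap.adjoint_isFormalAdjoint hAB.dense_opC_domain).symm u
      ⟨opC A B ⟨y, hy⟩, hy'⟩
    simp only [hu1, hu2, inner_smul_left, Complex.conj_ofReal, hAB.inner_basis_succ_opC,
      ← mul_assoc, ← Complex.ofReal_mul] at h1
    rw [inner_basis_diagonal h hT, inner_add_right, ← h1]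
    have h0 := level_pos hε n
    rw [Real.mul_self_sqrt h0.le]
    have h2 : invWeight ε n * (1 + ε * (n + 1)) = 1 := by
      unfold invWeight
      field_simp
    have h3 : (invWeight ε n : ℂ) * (1 + (ε * (n + 1) : ℝ)) = 1 := by
      rw [← Complex.ofReal_one, ← Complex.ofReal_add, ← Complex.ofReal_mul, h2]
    linear_combination ⟪h n, y⟫_ℂ * h3

theorem exists_compact_inverse (hAB : IsOscillator A B h ε) (hε : 0 < ε) :
    ∃ T : H →L[ℂ] H, IsBoundedInverse (delta A B) T ∧ IsCompactOperator T := by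
  obtain ⟨T, hT⟩ := exists_diagonal h (invWeight ε) (abs_invWeight_le hε)
  obtain ⟨S, hS⟩ := exists_weightedShift h (ladderWeight ε) (abs_ladderWeight_le hε)
  exact ⟨T, hAB.isBoundedInverse hε hT hS, isCompactOperator_diagonal h hT (tendsto_invWeight hε)⟩

/-- An oscillator with small commutator has invariant one. -/
theorem isOmegaSmall (hAB : IsOscillator A B h ε) (hε : 0 < ε) (hε' : ε ≤ 1 / 50) :
    IsOmegaSmall A B 1 := by
  obtain ⟨T, hT⟩ := exists_diagonal h (invWeight ε) (abs_invWeight_le hε)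
  obtain ⟨S, hS⟩ := exists_weightedShift h (ladderWeight ε) (abs_ladderWeight_le hε)
  have hQ := norm_oscillator_sq_sub_lt hε hε' hT hS
  have hTc := isCompactOperator_diagonal h hT (tendsto_invWeight hε)
  obtain ⟨hSc, hSc'⟩ := isCompactOperator_weightedShift h hS (abs_ladderWeight_le hε)
    (tendsto_ladderWeight hε)
  refine ⟨blockOp T S (adjoint S) (1 - T),
    ⟨T, S, hAB.isBoundedInverse hε hT hS, hAB.exists_opC_eq hT hS, rfl⟩, hQ, fun e => ?_⟩
  have hTa := adjoint_diagonal h hT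
  have hTa' : adjoint (1 - T) = 1 - T := by
    rw [map_sub, hTa]
    congr 1
    exact star_one (H →L[ℂ] H)
  filter_upwards [eventually_norm_corner_sq_sub_lt hTc hSc hSc' hTc rfl hQ e,
    eventually_card_eigenvalues hε hε' hT hS e] with N h1 h2
  exact ⟨h1, isHermitian_corner (inner_blockOp_symm hTa hTa') e N, h2 _⟩

end IsOscillator

end Ladder

/-! ### Von Neumann's criterion for graphs. -/

section Deficiency

variable {H : Type*} [NormedAddCommGroup H] [InnerProductSpace ℂ H] [CompleteSpace H]

/-- Von Neumann's criterion: if a symmetric graph `G` has trivial deficiency spaces, then its adjoint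
relation is symmetric. -/
theorem adjoint_symmetric_of_deficiency {G : Submodule ℂ (H × H)}
    (hG : ∀ p ∈ G, ∀ q ∈ G, ⟪p.2, q.1⟫_ℂ = ⟪p.1, q.2⟫_ℂ)
    (hpos : ∀ f : H, (∀ q ∈ G, ⟪Complex.I • f, q.1⟫_ℂ = ⟪f, q.2⟫_ℂ) → f = 0)
    (hneg : ∀ f : H, (∀ q ∈ G, ⟪-Complex.I • f, q.1⟫_ℂ = ⟪f, q.2⟫_ℂ) → f = 0)
    {p p' : H × H} (hp : ∀ q ∈ G, ⟪p.2, q.1⟫_ℂ = ⟪p.1, q.2⟫_ℂ)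
    (hp' : ∀ q ∈ G, ⟪p'.2, q.1⟫_ℂ = ⟪p'.1, q.2⟫_ℂ) : ⟪p.2, p'.1⟫_ℂ = ⟪p.1, p'.2⟫_ℂ := by
  have flip : ∀ a b : H × H, ⟪a.2, b.1⟫_ℂ = ⟪a.1, b.2⟫_ℂ → ⟪b.2, a.1⟫_ℂ = ⟪b.1, a.2⟫_ℂ := by
    intro a b hab
    rw [← inner_conj_symm, ← hab, inner_conj_symm]
  have hcl : ∀ r : H × H, (∀ q ∈ G, ⟪r.2, q.1⟫_ℂ = ⟪r.1, q.2⟫_ℂ) →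
      ∀ q ∈ G.topologicalClosure, ⟪r.2, q.1⟫_ℂ = ⟪r.1, q.2⟫_ℂ := by
    intro r hr q hq
    have hc : IsClosed {q : H × H | ⟪r.2, q.1⟫_ℂ = ⟪r.1, q.2⟫_ℂ} :=
      isClosed_eq (by fun_prop) (by fun_prop)
    exact closure_minimal (fun q hq => hr q hq) hc hq
  have hM : ∀ q ∈ G.topologicalClosure, ∀ r ∈ G, ⟪q.2, r.1⟫_ℂ = ⟪q.1, r.2⟫_ℂ :=
    fun q hq r hr => flip _ _ (hcl r (hG r hr) q hq)
  -- The map `(a, b) ↦ b + i a` on the closed symmetric graph satisfies `‖b + i a‖² = ‖b‖² + ‖a‖²`.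
  -- Its range is therefore closed, and by `hpos` it is everything.
  let Θ : G.topologicalClosure →L[ℂ] H :=
    (ContinuousLinearMap.snd ℂ H H + Complex.I • ContinuousLinearMap.fst ℂ H H) ∘L
      G.topologicalClosure.subtypeL
  have hΘ : ∀ q, Θ q = q.1.2 + Complex.I • q.1.1 := fun q => rfl
  have hnorm : ∀ q : G.topologicalClosure, ‖Θ q‖ ^ 2 = ‖q.1.2‖ ^ 2 + ‖q.1.1‖ ^ 2 := by
    intro q
    have h1 : ⟪q.1.2, q.1.1⟫_ℂ = ⟪q.1.1, q.1.2⟫_ℂ := hcl _ (hM q q.2) q q.2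
    have h2 : (⟪q.1.2, q.1.1⟫_ℂ).im = 0 := by
      rw [← Complex.conj_eq_iff_im, inner_conj_symm, h1]
    rw [hΘ, norm_add_sq (𝕜 := ℂ), inner_smul_right, norm_smul, Complex.norm_I, one_mul]
    have h3 : (Complex.I * ⟪q.1.2, q.1.1⟫_ℂ).re = 0 := by
      rw [Complex.I_mul_re, h2, neg_zero]
    have h4 : RCLike.re (Complex.I * ⟪q.1.2, q.1.1⟫_ℂ) = 0 := h3
    rw [h4]
    ring
  have hanti : AntilipschitzWith 1 Θ := by
    refine AddMonoidHomClass.antilipschitz_of_bound Θ fun q => ?_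
    rw [NNReal.coe_one, one_mul]
    refine max_le ?_ ?_
    · refine le_of_sq_le_sq ?_ (norm_nonneg _)
      rw [hnorm]
      exact le_add_of_nonneg_left (sq_nonneg _)
    · refine le_of_sq_le_sq ?_ (norm_nonneg _)
      rw [hnorm]
      exact le_add_of_nonneg_right (sq_nonneg _)
  have : CompleteSpace G.topologicalClosure :=
    (G.isClosed_topologicalClosure).completeSpace_coe
  have hrange : IsClosed (LinearMap.range Θ.toLinearMap : Set H) := by
    rw [LinearMap.coe_range]
    exact hanti.isClosed_range Θ.uniformContinuous
  have htop : LinearMap.range Θ.toLinearMap = ⊤ := by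
    have : CompleteSpace (LinearMap.range Θ.toLinearMap) := hrange.completeSpace_coe
    rw [← Submodule.orthogonal_eq_bot_iff, Submodule.eq_bot_iff]
    intro w hw
    refine hpos w fun q hq => ?_
    have h1 := (Submodule.mem_orthogonal' _ _).mp hw
      (Θ ⟨q, G.le_topologicalClosure hq⟩) ⟨_, rfl⟩
    rw [hΘ, inner_add_right, inner_smul_right] at h1
    rw [inner_smul_left, Complex.conj_I]
    linear_combination -h1
  have hsurj : ∃ q : G.topologicalClosure, Θ q = p.2 + Complex.I • p.1 := by
    have : p.2 + Complex.I • p.1 ∈ LinearMap.range Θ.toLinearMap := htop ▸ Submodule.mem_top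
    exact this
  obtain ⟨q, hq⟩ := hsurj
  rw [hΘ] at hq
  -- The element `q` of the closure has the same image as `p`, so `p - q` lies in the other
  -- deficiency space and vanishes. Thus `p` is in the closure of `G`, where `p'` pairs
  -- symmetrically.
  have hd : p.2 - q.1.2 = -Complex.I • (p.1 - q.1.1) := by
    rw [neg_smul, smul_sub, neg_sub, sub_eq_sub_iff_add_eq_add, ← hq, add_comm]
  have hzero : p.1 - q.1.1 = 0 := by
    refine hneg _ fun r hr => ?_
    rw [← hd, inner_sub_left, inner_sub_left, hp r hr, hM q q.2 r hr]
  have hpq : p = q := by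
    refine Prod.ext (sub_eq_zero.mp hzero) (sub_eq_zero.mp ?_)
    rw [hd, hzero, smul_zero]
  rw [hpq]
  exact flip _ _ (hcl p' hp' q q.2)

end Deficiency

/-! ### Weak solutions of `g' = 0` and of `w' = σw`. -/

section WeakDerivative

open scoped ContDiff

theorem exists_antideriv {θ : ℝ → ℝ} (hθ : ContDiff ℝ ∞ θ) (hc : HasCompactSupport θ)
    (h0 : ∫ x, θ x = 0) :
    ∃ Φ : ℝ → ℝ, ContDiff ℝ ∞ Φ ∧ HasCompactSupport Φ ∧ ∀ x, HasDerivAt Φ (θ x) x := by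
  obtain ⟨R, hR⟩ := hc.isCompact.isBounded.subset_closedBall 0
  rw [Real.closedBall_eq_Icc, zero_sub, zero_add] at hR
  have hz : ∀ x, x ∉ Set.Icc (-R) R → θ x = 0 := fun x hx =>
    image_eq_zero_of_notMem_tsupport fun h => hx (hR h)
  have hcont := hθ.continuous
  have hderiv : ∀ x, HasDerivAt (fun y => ∫ t in (-(R + 1))..y, θ t) (θ x) x := fun x =>
    intervalIntegral.integral_hasDerivAt_right (hcont.intervalIntegrable _ _)
      (hcont.stronglyMeasurableAtFilter _ _) hcont.continuousAt
  -- Integration starts to the left of the support; past the support the value is the total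
  -- integral, which is zero by `h0`.
  refine ⟨fun x => ∫ t in (-(R + 1))..x, θ t, ?_, ?_, hderiv⟩
  · rw [contDiff_infty_iff_deriv]
    refine ⟨fun x => (hderiv x).differentiableAt, ?_⟩
    rwa [funext fun x => (hderiv x).deriv]
  · refine HasCompactSupport.intro (K := Set.Icc (-(R + 1)) (R + 1)) isCompact_Icc fun x hx => ?_
    rcases lt_or_ge x (-(R + 1)) with hx1 | hx1
    · refine intervalIntegral.integral_zero_ae (ae_of_all _ fun t ht => hz t fun ht' => ?_)
      rw [Set.uIoc_of_ge hx1.le] at ht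
      linarith [ht.2, ht'.1]
    · have hx2 : R + 1 < x := by
        by_contra hle
        exact hx ⟨hx1, not_lt.mp hle⟩
      rw [← h0, intervalIntegral.integral_of_le hx1]
      refine setIntegral_eq_integral_of_forall_compl_eq_zero fun t ht => hz t fun ht' => ?_
      exact ht ⟨by linarith [ht'.1], by linarith [ht'.2]⟩

/-- The lemma of du Bois-Reymond: a function with vanishing weak derivative is constant. -/
theorem ae_eq_const_of_integral_mul_deriv_eq_zero {g : ℝ → ℂ} (hg : LocallyIntegrable g)
    (hz : ∀ φ : ℝ → ℂ, ContDiff ℝ ∞ φ → HasCompactSupport φ → ∫ x, g x * deriv φ x = 0) :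
    ∃ c : ℂ, ∀ᵐ x, g x = c := by
  let b : ContDiffBump (0 : ℝ) := default
  set ρ : ℝ → ℝ := b.normed volume with hρ
  have hρs : ContDiff ℝ ∞ ρ := b.contDiff_normed
  have hρc : HasCompactSupport ρ := b.hasCompactSupport_normed
  have hρi : ∫ x, ρ x = 1 := b.integral_normed
  have hψg : ∀ ψ : ℝ → ℝ, ContDiff ℝ ∞ ψ → HasCompactSupport ψ →
      Integrable fun x => ψ x • g x := fun ψ h1 h2 =>
    hg.integrable_smul_left_of_hasCompactSupport h1.continuous h2
  refine ⟨∫ x, ρ x • g x, ?_⟩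
  set c := ∫ x, ρ x • g x with hc
  have key : ∀ᵐ x, g x - c = 0 := by
    refine ae_eq_zero_of_integral_contDiff_smul_eq_zero (hg.sub (locallyIntegrable_const c))
      fun ψ h1 h2 => ?_
    set m := ∫ x, ψ x with hm
    have hψi : Integrable ψ := h1.continuous.integrable_of_hasCompactSupport h2
    have hρi' : Integrable ρ := hρs.continuous.integrable_of_hasCompactSupport hρc
    -- Subtracting `m ρ` makes the integral vanish, so `ψ - m ρ` is the derivative of a test
    -- function and `g` annihilates it.
    obtain ⟨Φ, hΦs, hΦc, hΦ⟩ := exists_antideriv (θ := fun x => ψ x - m * ρ x)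
      (h1.sub (contDiff_const.mul hρs)) (h2.sub (hρc.mul_left)) (by
        rw [integral_sub hψi (hρi'.const_mul m), integral_const_mul, hρi, mul_one, sub_self])
    have h3 := hz (fun x => (Φ x : ℂ)) (Complex.ofRealCLM.contDiff.comp hΦs)
      (hΦc.comp_left Complex.ofReal_zero)
    have h4 : ∀ x, g x * deriv (fun x => (Φ x : ℂ)) x = ψ x • g x - (m : ℂ) * (ρ x • g x) := by
      intro x
      rw [(hΦ x).ofReal_comp.deriv]
      simp only [Complex.real_smul]
      push_cast
      ring
    simp only [h4] at h3
    rw [integral_sub (hψg ψ h1 h2) ((hψg ρ hρs hρc).const_mul _), integral_const_mul, ← hc] at h3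
    have h5 : ∀ x, ψ x • (g x - c) = ψ x • g x - (ψ x : ℂ) * c := fun x => by
      rw [smul_sub, Complex.real_smul, Complex.real_smul]
    simp only [h5]
    have h6 : Integrable fun x => (ψ x : ℂ) * c := hψi.ofReal.mul_const c
    rw [integral_sub (hψg ψ h1 h2) h6, integral_mul_const,
      integral_complex_ofReal, ← hm]
    exact h3
  filter_upwards [key] with x hx using sub_eq_zero.mp hx

/-- The equation `w' = σ w`, `σ = ±1`, has no nonzero weak solution in `L²(ℝ)`. -/
theorem eq_zero_of_integral_mul_deriv_add (w : L2R) {σ : ℝ} (hσ : σ ≠ 0)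
    (hw : ∀ φ : ℝ → ℂ, ContDiff ℝ ∞ φ → HasCompactSupport φ →
      ∫ x, w x * (deriv φ x + σ * φ x) = 0) : w = 0 := by
  have hloc : LocallyIntegrable (fun x => w x) := (Lp.memLp w).locallyIntegrable (by norm_num)
  have hexp : ContDiff ℝ ∞ fun x : ℝ => Real.exp (-σ * x) :=
    Real.contDiff_exp.comp (contDiff_const.mul contDiff_id)
  -- The integrating factor `exp(-σx)` reduces the equation to a vanishing weak derivative, so `w =
  -- c exp(σx)`.
  have hgloc : LocallyIntegrable fun x => Real.exp (-σ * x) • w x :=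
    hloc.continuous_smul hexp.continuous
  obtain ⟨c, hc⟩ := ae_eq_const_of_integral_mul_deriv_eq_zero hgloc fun χ h1 h2 => by
    have hexpC : ContDiff ℝ ∞ fun x : ℝ => (Real.exp (-σ * x) : ℂ) :=
      Complex.ofRealCLM.contDiff.comp hexp
    have hd : ∀ x : ℝ, HasDerivAt (fun x : ℝ => (Real.exp (-σ * x) : ℂ))
        ((-σ * Real.exp (-σ * x) : ℝ) : ℂ) x := fun x => by
      have h3 : HasDerivAt (fun x : ℝ => Real.exp (-σ * x)) (Real.exp (-σ * x) * (-σ * 1)) x :=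
        ((hasDerivAt_id x).const_mul (-σ)).exp
      convert h3.ofReal_comp using 1
      push_cast
      ring
    rw [← hw (fun x => (Real.exp (-σ * x) : ℂ) * χ x) (hexpC.mul h1) h2.mul_left]
    refine integral_congr_ae (ae_of_all _ fun x => ?_)
    have h4 : HasDerivAt χ (deriv χ x) x :=
      (h1.differentiable (by simp)).differentiableAt.hasDerivAt
    have h5 : deriv (fun x => (Real.exp (-σ * x) : ℂ) * χ x) x = _ := ((hd x).mul h4).deriv
    simp only [h5, Complex.real_smul]
    push_cast
    ring
  have hc' : ∀ᵐ x, w x = Real.exp (σ * x) * c := by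
    filter_upwards [hc] with x hx
    rw [← hx, Complex.real_smul, ← mul_assoc, ← Complex.ofReal_mul, ← Real.exp_add]
    simp
  have hc0 : c = 0 := by
    by_contra hne
    -- If `c ≠ 0`, then `|w| ≥ |c|` on the half-line `σx ≥ 0` of infinite measure, which is
    -- impossible in `L²`.
    have hfin := (Lp.memLp w).meas_ge_lt_top (by norm_num) (by norm_num)
      (ε := ‖c‖₊) (by simpa using hne)
    have hsub : ∀ᵐ x, x ∈ {x : ℝ | 0 ≤ σ * x} → x ∈ {x | ‖c‖₊ ≤ ‖w x‖₊} := by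
      filter_upwards [hc'] with x hx (hx0 : 0 ≤ σ * x)
      rw [← NNReal.coe_le_coe, coe_nnnorm, coe_nnnorm, hx, norm_mul, Complex.norm_real,
        Real.norm_of_nonneg (Real.exp_nonneg _)]
      exact le_mul_of_one_le_left (norm_nonneg _) (Real.one_le_exp hx0)
    have hle : volume {x : ℝ | 0 ≤ σ * x} ≤ volume {x | ‖c‖₊ ≤ ‖w x‖₊} := measure_mono_ae hsub
    have hinf : volume {x : ℝ | 0 ≤ σ * x} = ⊤ := by
      rcases lt_or_gt_of_ne hσ with h1 | h1
      · have : {x : ℝ | 0 ≤ σ * x} = Set.Iic 0 := by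
          ext x
          simp only [Set.mem_ofPred_eq, Set.mem_Iic]
          constructor <;> intro h <;> nlinarith
        rw [this, Real.volume_Iic]
      · have : {x : ℝ | 0 ≤ σ * x} = Set.Ici 0 := by
          ext x
          simp only [Set.mem_ofPred_eq, Set.mem_Ici]
          constructor <;> intro h <;> nlinarith
        rw [this, Real.volume_Ici]
    rw [hinf] at hle
    exact absurd (lt_of_le_of_lt hle hfin) (lt_irrefl _)
  refine Lp.ext ?_
  filter_upwards [hc', Lp.coeFn_zero ℂ 2 (volume : Measure ℝ)] with x hx h0
  rw [hx, hc0, mul_zero, h0]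
  rfl

end WeakDerivative

/-! ### Self-adjointness of position and momentum. -/

section SelfAdjoint

open scoped ContDiff ComplexConjugate

theorem L2R_inner_eq (f g : L2R) : ⟪f, g⟫_ℂ = ∫ x, conj (f x) * g x := by
  rw [L2.inner_def]
  refine integral_congr_ae (ae_of_all _ fun x => ?_)
  simp only [RCLike.inner_apply]
  ring

theorem integral_mul_congr {f g : L2R} {u v : ℝ → ℂ} (hf : f =ᵐ[volume] u) (hg : g =ᵐ[volume] v) :
    ⟪f, g⟫_ℂ = ∫ x, conj (u x) * v x := by
  rw [L2R_inner_eq]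
  refine integral_congr_ae ?_
  filter_upwards [hf, hg] with x h1 h2
  rw [h1, h2]

/-- A classical derivative is a weak derivative. -/
theorem isWeakDeriv_of_hasDerivAt {f g : L2R} {u u' : ℝ → ℂ} (hf : f =ᵐ[volume] u)
    (hg : g =ᵐ[volume] u') (hd : ∀ x, HasDerivAt u (u' x) x) : IsWeakDeriv f g := by
  intro φ h1 h2
  have hφ : Continuous (deriv φ) := h1.continuous_deriv (by simp)
  have e : ∀ {k : L2R} {v ψ : ℝ → ℂ}, k =ᵐ[volume] v →
      (fun x => k x * ψ x) =ᵐ[volume] fun x => v x * ψ x := fun hk => by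
    filter_upwards [hk] with x hx
    rw [hx]
  rw [integral_congr_ae (e hf), integral_congr_ae (e hg)]
  refine integral_mul_deriv_eq_deriv_mul_of_integrable (fun x _ => hd x)
    (fun x _ => (h1.differentiable (by simp)).differentiableAt.hasDerivAt) ?_ ?_ ?_
  · exact (integrable_mul_test f hφ h2.deriv).congr (e hf)
  · exact (integrable_mul_test g h1.continuous h2).congr (e hg)
  · exact (integrable_mul_test f h1.continuous h2).congr (e hf)

theorem exists_L2R_of_test {φ : ℝ → ℂ} (h1 : Continuous φ) (h2 : HasCompactSupport φ) :
    ∃ f : L2R, f =ᵐ[volume] φ :=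
  ⟨(h1.memLp_of_hasCompactSupport h2).toLp φ, MemLp.coeFn_toLp _⟩

/-- The graph of `-i d/dx` on smooth compactly supported functions. -/
def testGraph : Submodule ℂ (L2R × L2R) where
  carrier := {p | ∃ φ : ℝ → ℂ, ContDiff ℝ ∞ φ ∧ HasCompactSupport φ ∧ p.1 =ᵐ[volume] φ ∧
    p.2 =ᵐ[volume] fun x => -Complex.I * deriv φ x}
  zero_mem' := ⟨fun _ => 0, contDiff_const, HasCompactSupport.zero,
    Lp.coeFn_zero ℂ 2 volume,
    (Lp.coeFn_zero ℂ 2 volume).trans (.of_forall fun _ => by simp)⟩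
  add_mem' := by
    rintro p q ⟨φ, a1, a2, a3, a4⟩ ⟨ψ, b1, b2, b3, b4⟩
    refine ⟨fun x => φ x + ψ x, a1.add b1, a2.add b2, ?_, ?_⟩
    · filter_upwards [Lp.coeFn_add p.1 q.1, a3, b3] with x h1 h2 h3
      simp only [Prod.fst_add, h1, Pi.add_apply, h2, h3]
    · filter_upwards [Lp.coeFn_add p.2 q.2, a4, b4] with x h1 h2 h3
      rw [deriv_fun_add (a1.differentiable (by simp)).differentiableAt
        (b1.differentiable (by simp)).differentiableAt]
      simp only [Prod.snd_add, h1, Pi.add_apply, h2, h3]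
      ring
  smul_mem' := by
    rintro c p ⟨φ, a1, a2, a3, a4⟩
    refine ⟨fun x => c * φ x, contDiff_const.mul a1, a2.mul_left, ?_, ?_⟩
    · filter_upwards [Lp.coeFn_smul c p.1, a3] with x h1 h2
      simp only [Prod.smul_fst, h1, Pi.smul_apply, h2, smul_eq_mul]
    · filter_upwards [Lp.coeFn_smul c p.2, a4] with x h1 h2
      rw [deriv_const_mul _ (a1.differentiable (by simp)).differentiableAt]
      simp only [Prod.smul_snd, h1, Pi.smul_apply, h2, smul_eq_mul]
      ring

theorem exists_mem_testGraph {φ : ℝ → ℂ} (h1 : ContDiff ℝ ∞ φ) (h2 : HasCompactSupport φ) :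
    ∃ p ∈ testGraph, p.1 =ᵐ[volume] φ ∧ p.2 =ᵐ[volume] fun x => -Complex.I * deriv φ x := by
  obtain ⟨f, hf⟩ := exists_L2R_of_test h1.continuous h2
  obtain ⟨g, hg⟩ := exists_L2R_of_test (φ := fun x => -Complex.I * deriv φ x)
    (continuous_const.mul (h1.continuous_deriv (by simp))) h2.deriv.mul_left
  exact ⟨(f, g), ⟨φ, h1, h2, hf, hg⟩, hf, hg⟩

theorem deriv_conj {φ : ℝ → ℂ} (h1 : ContDiff ℝ ∞ φ) (x : ℝ) :
    deriv (fun x => conj (φ x)) x = conj (deriv φ x) :=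
  (Complex.conjCLE.hasFDerivAt.comp_hasDerivAt x
    (h1.differentiable (by simp)).differentiableAt.hasDerivAt).deriv

theorem contDiff_conj {φ : ℝ → ℂ} (h1 : ContDiff ℝ ∞ φ) : ContDiff ℝ ∞ fun x => conj (φ x) :=
  Complex.conjCLE.contDiff.comp h1

theorem hasCompactSupport_conj {φ : ℝ → ℂ} (h1 : HasCompactSupport φ) :
    HasCompactSupport fun x => conj (φ x) :=
  h1.comp_left (map_zero _)

/-- The momentum operator is the adjoint of its restriction to smooth compactly supported
functions. -/
theorem mem_momentumGraph_iff (p : L2R × L2R) :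
    p ∈ momentumGraph ↔ ∀ q ∈ testGraph, ⟪p.2, q.1⟫_ℂ = ⟪p.1, q.2⟫_ℂ := by
  -- The inner product conjugates its first slot, so pairing with `φ` is testing the weak derivative
  -- against the conjugate of `φ`.
  have key : ∀ (φ : ℝ → ℂ), ContDiff ℝ ∞ φ → ∀ q : L2R × L2R, q.1 =ᵐ[volume] φ →
      q.2 =ᵐ[volume] (fun x => -Complex.I * deriv φ x) →
      (⟪p.2, q.1⟫_ℂ = ⟪p.1, q.2⟫_ℂ ↔
        ∫ x, p.1 x * deriv (fun x => conj (φ x)) x =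
          -∫ x, (Complex.I • p.2 : L2R) x * conj (φ x)) := by
    intro φ h1 q hq1 hq2
    have e1 : ⟪p.2, q.1⟫_ℂ = conj (∫ x, p.2 x * conj (φ x)) := by
      rw [integral_mul_congr (EventuallyEq.refl _ _) hq1, ← integral_conj]
      simp
    have e2 : ⟪p.1, q.2⟫_ℂ = conj (Complex.I * ∫ x, p.1 x * deriv (fun x => conj (φ x)) x) := by
      rw [integral_mul_congr (EventuallyEq.refl _ _) hq2, ← integral_const_mul, ← integral_conj]
      refine integral_congr_ae (ae_of_all _ fun x => ?_)
      simp only [deriv_conj h1, map_mul, Complex.conj_conj, Complex.conj_I]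
      ring
    have e3 : ∫ x, (Complex.I • p.2 : L2R) x * conj (φ x) =
        Complex.I * ∫ x, p.2 x * conj (φ x) := by
      rw [← integral_const_mul]
      refine integral_congr_ae ?_
      filter_upwards [Lp.coeFn_smul Complex.I p.2] with x hx
      rw [hx, Pi.smul_apply, smul_eq_mul, mul_assoc]
    rw [e1, e2, e3, (starRingEnd ℂ).injective.eq_iff]
    constructor
    · intro h
      rw [h, ← mul_assoc, Complex.I_mul_I]; ring
    · intro h
      rw [h, mul_neg, ← mul_assoc, Complex.I_mul_I]; ring
  constructor
  · rintro hp q ⟨φ, h1, h2, h3, h4⟩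
    exact (key φ h1 q h3 h4).mpr (hp _ (contDiff_conj h1) (hasCompactSupport_conj h2))
  · intro hp φ h1 h2
    obtain ⟨q, hq, hq1, hq2⟩ := exists_mem_testGraph (contDiff_conj h1) (hasCompactSupport_conj h2)
    have := (key _ (contDiff_conj h1) q hq1 hq2).mp (hp q hq)
    simpa only [Complex.conj_conj] using this

theorem testGraph_le_momentumGraph : testGraph ≤ momentumGraph := by
  rintro p ⟨φ, h1, h2, h3, h4⟩
  refine isWeakDeriv_of_hasDerivAt (u' := deriv φ) h3 ?_ fun x =>
    (h1.differentiable (by simp)).differentiableAt.hasDerivAt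
  filter_upwards [Lp.coeFn_smul Complex.I p.2, h4] with x hx hx'
  rw [hx, Pi.smul_apply, hx', smul_eq_mul, ← mul_assoc, mul_neg, Complex.I_mul_I]
  ring

/-- The eigenvalue equation `-i f' = iσ f` reads `f' = -σ f`. The cases `σ = ±1` are the two
deficiency equations. -/
theorem eq_zero_of_mem_momentumGraph_smul {f : L2R} {σ : ℝ} (hσ : σ ≠ 0)
    (hf : (f, ((σ : ℂ) * Complex.I) • f) ∈ momentumGraph) : f = 0 := by
  refine eq_zero_of_integral_mul_deriv_add f (neg_ne_zero.mpr hσ) fun φ h1 h2 => ?_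
  have h3 : ∫ x, f x * deriv φ x = -∫ x, (Complex.I • ((σ : ℂ) * Complex.I) • f : L2R) x * φ x :=
    hf φ h1 h2
  rw [smul_smul] at h3
  have h4 : ∫ x, ((Complex.I * ((σ : ℂ) * Complex.I)) • f : L2R) x * φ x =
      -∫ x, f x * (σ * φ x) := by
    rw [← integral_neg]
    refine integral_congr_ae ?_
    filter_upwards [Lp.coeFn_smul (Complex.I * ((σ : ℂ) * Complex.I)) f] with x hx
    rw [hx, Pi.smul_apply, smul_eq_mul]
    linear_combination (σ * f x * φ x : ℂ) * Complex.I_mul_I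
  rw [h4, neg_neg] at h3
  have h5 : ∀ x, f x * (deriv φ x + ((-σ : ℝ) : ℂ) * φ x) = f x * deriv φ x - f x * (σ * φ x) :=
    fun x => by push_cast; ring
  have h6 : Integrable fun x => f x * (σ * φ x) :=
    integrable_mul_test f (continuous_const.mul h1.continuous) h2.mul_left
  simp only [h5]
  rw [integral_sub (integrable_mul_test f (h1.continuous_deriv (by simp)) h2.deriv) h6, h3,
    sub_self]

/-- `momentumGraph` is the adjoint relation of `testGraph`, whose deficiency spaces are trivial. -/
theorem momentum_isFormalAdjoint : momentum.IsFormalAdjoint momentum := by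
  intro x y
  have hx : ((x : L2R), momentum x) ∈ momentumGraph :=
    momentum_graph ▸ momentum.mem_graph x
  have hy : ((y : L2R), momentum y) ∈ momentumGraph :=
    momentum_graph ▸ momentum.mem_graph y
  have hdef : ∀ {σ : ℝ}, σ ≠ 0 → ∀ f : L2R,
      (∀ q ∈ testGraph, ⟪((σ : ℂ) * Complex.I) • f, q.1⟫_ℂ = ⟪f, q.2⟫_ℂ) → f = 0 :=
    fun hσ f hf => eq_zero_of_mem_momentumGraph_smul hσ ((mem_momentumGraph_iff _).mpr hf)
  refine adjoint_symmetric_of_deficiency (G := testGraph)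
    (p := ((x : L2R), momentum x)) (p' := ((y : L2R), momentum y)) ?_ ?_ ?_
    ((mem_momentumGraph_iff _).mp hx) ((mem_momentumGraph_iff _).mp hy)
  · exact fun p hp => (mem_momentumGraph_iff p).mp (testGraph_le_momentumGraph hp)
  · simpa only [Complex.ofReal_one, one_mul] using hdef one_ne_zero
  · simpa only [Complex.ofReal_neg, Complex.ofReal_one, neg_one_mul] using
      hdef (σ := -1) (by norm_num)

/-- Symmetry gives one inclusion. For the other, the adjoint of momentum is contained in the adjoint
of its restriction to test functions, which is momentum itself. -/
theorem momentum_isSelfAdjoint (hd : Dense (momentum.domain : Set L2R)) :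
    IsSelfAdjoint momentum := by
  rw [LinearPMap.isSelfAdjoint_def]
  refine le_antisymm (LinearPMap.le_of_le_graph ?_) (momentum_isFormalAdjoint.le_adjoint hd)
  rw [LinearPMap.adjoint_graph_eq_graph_adjoint hd, momentum_graph]
  intro p hp
  rw [mem_momentumGraph_iff]
  intro q hq
  have h1 := (Submodule.mem_adjoint_iff _ _).mp hp q.1 q.2 (testGraph_le_momentumGraph hq)
  rw [← inner_conj_symm, ← sub_eq_zero.mp h1, inner_conj_symm]

theorem mem_positionGraph_iff (p : L2R × L2R) :
    p ∈ positionGraph ↔ p.2 =ᵐ[volume] fun x : ℝ => (x : ℂ) * p.1 x := Iff.rfl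

theorem position_isFormalAdjoint : position.IsFormalAdjoint position := by
  intro x y
  have hx : ((x : L2R), position x) ∈ positionGraph := position_graph ▸ position.mem_graph x
  have hy : ((y : L2R), position y) ∈ positionGraph := position_graph ▸ position.mem_graph y
  rw [integral_mul_congr ((mem_positionGraph_iff _).mp hx) (EventuallyEq.refl _ _),
    integral_mul_congr (EventuallyEq.refl _ _) ((mem_positionGraph_iff _).mp hy)]
  refine integral_congr_ae (ae_of_all _ fun t => ?_)
  simp only [map_mul, Complex.conj_ofReal]
  ring

theorem position_isSelfAdjoint (hd : Dense (position.domain : Set L2R)) :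
    IsSelfAdjoint position := by
  rw [LinearPMap.isSelfAdjoint_def]
  refine le_antisymm (LinearPMap.le_of_le_graph ?_) (position_isFormalAdjoint.le_adjoint hd)
  rw [LinearPMap.adjoint_graph_eq_graph_adjoint hd, position_graph]
  intro p hp
  rw [mem_positionGraph_iff]
  have hl1 : LocallyIntegrable fun x => p.1 x := (Lp.memLp p.1).locallyIntegrable (by norm_num)
  have hl2 : LocallyIntegrable fun x => p.2 x := (Lp.memLp p.2).locallyIntegrable (by norm_num)
  have hl3 : LocallyIntegrable fun x : ℝ => x • p.1 x := hl1.continuous_smul continuous_id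
  -- Pairing an element of the adjoint graph with `(ψ, xψ)` for real test functions `ψ` identifies
  -- its second entry.
  have hz : ∀ᵐ x, p.2 x - x • p.1 x = 0 := by
    refine ae_eq_zero_of_integral_contDiff_smul_eq_zero (hl2.sub hl3) fun ψ h1 h2 => ?_
    have c1 : Continuous fun x => (ψ x : ℂ) := Complex.continuous_ofReal.comp h1.continuous
    have c2 : HasCompactSupport fun x => (ψ x : ℂ) := h2.comp_left Complex.ofReal_zero
    obtain ⟨a, ha⟩ := exists_L2R_of_test c1 c2
    obtain ⟨b, hb⟩ := exists_L2R_of_test (φ := fun x : ℝ => (x : ℂ) * (ψ x : ℂ))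
      (Complex.continuous_ofReal.mul c1) c2.mul_left
    have hab : (a, b) ∈ positionGraph := by
      rw [mem_positionGraph_iff]
      filter_upwards [ha, hb] with x hxa hxb
      rw [hxa, hxb]
    have h3 := (Submodule.mem_adjoint_iff _ _).mp hp a b hab
    rw [integral_mul_congr hb (EventuallyEq.refl _ _),
      integral_mul_congr ha (EventuallyEq.refl _ _)] at h3
    have i1 : Integrable fun x => ψ x • p.2 x :=
      hl2.integrable_smul_left_of_hasCompactSupport h1.continuous h2
    have i2 : Integrable fun x => ψ x • (x • p.1 x) :=
      hl3.integrable_smul_left_of_hasCompactSupport h1.continuous h2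
    simp only [smul_sub]
    rw [integral_sub i1 i2, ← neg_sub, neg_eq_zero, ← h3]
    congr 1
    · refine integral_congr_ae (ae_of_all _ fun x => ?_)
      simp only [Complex.real_smul, map_mul, Complex.conj_ofReal]
      ring
    · refine integral_congr_ae (ae_of_all _ fun x => ?_)
      simp only [Complex.real_smul, Complex.conj_ofReal]
  filter_upwards [hz] with x hx
  rw [sub_eq_zero.mp hx, Complex.real_smul]

end SelfAdjoint

/-! ### Hermite functions for the weight `exp(-βx²)`. -/

section Hermite

open Polynomial
open scoped ContDiff ComplexConjugate

/-- The function `p(x) exp(-βx²/2)`. -/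
def gaussFun (β : ℝ) (p : ℝ[X]) (x : ℝ) : ℝ := p.eval x * Real.exp (-(β / 2) * x ^ 2)

theorem integrable_eval_mul_exp {b : ℝ} (hb : 0 < b) (p : ℝ[X]) :
    Integrable fun x : ℝ => p.eval x * Real.exp (-b * x ^ 2) := by
  induction p using Polynomial.induction_on' with
  | add p q hp hq =>
    refine (hp.add hq).congr (ae_of_all _ fun x => ?_)
    simp only [Pi.add_apply, eval_add, add_mul]
  | monomial n a =>
    have h1 := integrable_rpow_mul_exp_neg_mul_sq hb (s := n)
      (by linarith [(n.cast_nonneg : (0 : ℝ) ≤ n)])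
    refine (h1.const_mul a).congr (ae_of_all _ fun x => ?_)
    simp only [eval_monomial, Real.rpow_natCast, mul_assoc]

theorem gaussFun_mul (β : ℝ) (p q : ℝ[X]) (x : ℝ) :
    gaussFun β p x * gaussFun β q x = (p * q).eval x * Real.exp (-β * x ^ 2) := by
  have : Real.exp (-β * x ^ 2) = Real.exp (-(β / 2) * x ^ 2) * Real.exp (-(β / 2) * x ^ 2) := by
    rw [← Real.exp_add]; ring_nf
  rw [this, gaussFun, gaussFun, eval_mul]
  ring

theorem hasDerivAt_gaussFun (β : ℝ) (p : ℝ[X]) (x : ℝ) :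
    HasDerivAt (gaussFun β p) (gaussFun β (derivative p - C β * X * p) x) x := by
  have h1 : HasDerivAt (fun x : ℝ => -(β / 2) * x ^ 2) (-(β / 2) * (2 * x)) x := by
    simpa using (hasDerivAt_pow 2 x).const_mul (-(β / 2))
  have h2 := (p.hasDerivAt x).mul h1.exp
  refine h2.congr_deriv ?_
  simp only [gaussFun, eval_sub, eval_mul, eval_C, eval_X]
  ring

theorem continuous_gaussFun (β : ℝ) (p : ℝ[X]) : Continuous (gaussFun β p) :=
  continuous_iff_continuousAt.mpr fun x => (hasDerivAt_gaussFun β p x).continuousAt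

theorem memLp_gaussFun {β : ℝ} (hβ : 0 < β) (p : ℝ[X]) : MemLp (gaussFun β p) 2 volume := by
  rw [memLp_two_iff_integrable_sq (continuous_gaussFun β p).aestronglyMeasurable]
  refine (integrable_eval_mul_exp hβ (p * p)).congr (ae_of_all _ fun x => ?_)
  exact (gaussFun_mul β p p x).symm.trans (sq _).symm

theorem memLp_ofReal_gaussFun {β : ℝ} (hβ : 0 < β) (p : ℝ[X]) :
    MemLp (fun x => (gaussFun β p x : ℂ)) 2 volume :=
  (memLp_gaussFun hβ p).ofReal

/-- The integral of a polynomial against `exp(-βx²)`. -/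
def gaussInt (β : ℝ) (p : ℝ[X]) : ℝ := ∫ x : ℝ, p.eval x * Real.exp (-β * x ^ 2)

theorem gaussInt_C_mul (β c : ℝ) (p : ℝ[X]) : gaussInt β (C c * p) = c * gaussInt β p := by
  simp only [gaussInt, eval_mul, eval_C, mul_assoc]
  exact integral_const_mul _ _

theorem gaussInt_add {β : ℝ} (hβ : 0 < β) (p q : ℝ[X]) :
    gaussInt β (p + q) = gaussInt β p + gaussInt β q := by
  simp only [gaussInt, eval_add, add_mul]
  exact integral_add (integrable_eval_mul_exp hβ p) (integrable_eval_mul_exp hβ q)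

/-- The integrand is the derivative of `p(x) exp(-βx²)`, which decays at infinity. -/
theorem gaussInt_derivative {β : ℝ} (hβ : 0 < β) (p : ℝ[X]) :
    gaussInt β (derivative p - C (2 * β) * X * p) = 0 := by
  refine integral_eq_zero_of_hasDerivAt_of_integrable
    (f := fun x => p.eval x * Real.exp (-β * x ^ 2)) (fun x => ?_)
    (integrable_eval_mul_exp hβ _) (integrable_eval_mul_exp hβ _)
  have h1 : HasDerivAt (fun x : ℝ => -β * x ^ 2) (-β * (2 * x)) x := by
    simpa using (hasDerivAt_pow 2 x).const_mul (-β)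
  refine ((p.hasDerivAt x).mul h1.exp).congr_deriv ?_
  simp only [eval_sub, eval_mul, eval_C, eval_X]
  ring

theorem gaussInt_one_pos {β : ℝ} (hβ : 0 < β) : 0 < gaussInt β 1 := by
  simp only [gaussInt, eval_one, one_mul, integral_gaussian]
  positivity

/-- The element `p(x) exp(-βx²/2)` of `L²(ℝ)`. -/
def gaussLp {β : ℝ} (hβ : 0 < β) (p : ℝ[X]) : L2R := (memLp_ofReal_gaussFun hβ p).toLp _

theorem coeFn_gaussLp {β : ℝ} (hβ : 0 < β) (p : ℝ[X]) :
    gaussLp hβ p =ᵐ[volume] fun x => (gaussFun β p x : ℂ) := MemLp.coeFn_toLp _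

theorem gaussLp_C_mul {β : ℝ} (hβ : 0 < β) (c : ℝ) (p : ℝ[X]) :
    gaussLp hβ (C c * p) = (c : ℂ) • gaussLp hβ p := by
  refine Lp.ext ?_
  filter_upwards [coeFn_gaussLp hβ (C c * p), coeFn_gaussLp hβ p,
    Lp.coeFn_smul (c : ℂ) (gaussLp hβ p)] with x h1 h2 h3
  rw [h1, h3, Pi.smul_apply, h2, smul_eq_mul, ← Complex.ofReal_mul]
  simp only [gaussFun, eval_mul, eval_C, mul_assoc]

theorem gaussLp_add {β : ℝ} (hβ : 0 < β) (p q : ℝ[X]) :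
    gaussLp hβ (p + q) = gaussLp hβ p + gaussLp hβ q := by
  refine Lp.ext ?_
  filter_upwards [coeFn_gaussLp hβ (p + q), coeFn_gaussLp hβ p, coeFn_gaussLp hβ q,
    Lp.coeFn_add (gaussLp hβ p) (gaussLp hβ q)] with x h1 h2 h3 h4
  rw [h1, h4, Pi.add_apply, h2, h3, ← Complex.ofReal_add]
  simp only [gaussFun, eval_add, add_mul]

theorem gaussLp_zero {β : ℝ} (hβ : 0 < β) : gaussLp hβ 0 = 0 := by
  have := gaussLp_C_mul hβ 0 0
  simpa using this

theorem inner_gaussLp {β : ℝ} (hβ : 0 < β) (p q : ℝ[X]) :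
    ⟪gaussLp hβ p, gaussLp hβ q⟫_ℂ = (gaussInt β (p * q) : ℂ) := by
  rw [integral_mul_congr (coeFn_gaussLp hβ p) (coeFn_gaussLp hβ q), gaussInt,
    ← integral_complex_ofReal]
  refine integral_congr_ae (ae_of_all _ fun x => ?_)
  simp only [Complex.conj_ofReal, ← gaussFun_mul, Complex.ofReal_mul]

theorem gaussLp_mem_positionGraph {β : ℝ} (hβ : 0 < β) (p : ℝ[X]) :
    (gaussLp hβ p, gaussLp hβ (X * p)) ∈ positionGraph := by
  rw [mem_positionGraph_iff]
  filter_upwards [coeFn_gaussLp hβ p, coeFn_gaussLp hβ (X * p)] with x h1 h2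
  rw [h1, h2, ← Complex.ofReal_mul]
  simp only [gaussFun, eval_mul, eval_X, mul_assoc]

theorem gaussLp_mem_momentumGraph {β : ℝ} (hβ : 0 < β) (p : ℝ[X]) :
    (gaussLp hβ p, -Complex.I • gaussLp hβ (derivative p - C β * X * p)) ∈ momentumGraph := by
  refine isWeakDeriv_of_hasDerivAt (coeFn_gaussLp hβ p)
    (u' := fun x => (gaussFun β (derivative p - C β * X * p) x : ℂ)) ?_
    fun x => (hasDerivAt_gaussFun β p x).ofReal_comp
  rw [smul_smul, mul_neg, Complex.I_mul_I, neg_neg, one_smul]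
  exact coeFn_gaussLp hβ _

/-- The normalised Hermite polynomials for the weight `exp(-βx²)`. -/
def hermitePoly (β : ℝ) : ℕ → ℝ[X]
  | 0 => C (1 / √(gaussInt β 1))
  | n + 1 => C (1 / √(2 * β * (n + 1))) *
      (C (2 * β) * X * hermitePoly β n - derivative (hermitePoly β n))

theorem hermitePoly_raise {β : ℝ} (hβ : 0 < β) (n : ℕ) :
    C (2 * β) * X * hermitePoly β n - derivative (hermitePoly β n) =
      C (√(2 * β * (n + 1))) * hermitePoly β (n + 1) := by
  have h1 : √(2 * β * ((n : ℝ) + 1)) ≠ 0 := by positivity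
  rw [hermitePoly, ← mul_assoc, ← C_mul, mul_one_div_cancel h1, C_1, one_mul]

theorem derivative_hermitePoly_zero (β : ℝ) : derivative (hermitePoly β 0) = 0 := by
  rw [hermitePoly, derivative_C]

/-- The lowering relation, by induction from the raising one: `d/dx` and `2βx - d/dx` have
commutator `2β`, which increases the factor `2β(n+1)` by `2β` at each step. -/
theorem derivative_hermitePoly_succ {β : ℝ} (hβ : 0 < β) (n : ℕ) :
    derivative (hermitePoly β (n + 1)) = C (√(2 * β * (n + 1))) * hermitePoly β n := by
  have hr : ∀ n : ℕ, √(2 * β * ((n : ℝ) + 1)) ≠ 0 := fun n => by positivity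
  have hsq : ∀ n : ℕ, √(2 * β * ((n : ℝ) + 1)) * √(2 * β * ((n : ℝ) + 1)) = 2 * β * (n + 1) :=
    fun n => Real.mul_self_sqrt (by positivity)
  have hcancel : ∀ (n : ℕ) (p q : ℝ[X]),
      C (√(2 * β * ((n : ℝ) + 1))) * p = C (√(2 * β * ((n : ℝ) + 1))) * q → p = q := fun n p q h =>
    mul_left_cancel₀ (C_ne_zero.mpr (hr n)) h
  induction n with
  | zero =>
    apply hcancel 0
    have h1 := congrArg derivative (hermitePoly_raise hβ 0)
    rw [derivative_hermitePoly_zero, sub_zero, derivative_C_mul] at h1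
    rw [← h1, ← mul_assoc, ← C_mul, hsq]
    simp only [derivative_mul, derivative_C, derivative_X, derivative_hermitePoly_zero]
    simp
  | succ n ih =>
    apply hcancel (n + 1)
    have h1 := congrArg derivative (hermitePoly_raise hβ (n + 1))
    rw [derivative_C_mul] at h1
    rw [← h1, ← mul_assoc, ← C_mul, hsq, ih]
    simp only [derivative_sub, derivative_mul, derivative_C, derivative_X, ih]
    have h2 := hermitePoly_raise hβ n
    have h3 : (C (√(2 * β * ((n : ℝ) + 1))) : ℝ[X]) * C (√(2 * β * ((n : ℝ) + 1))) =
        C (2 * β * (n + 1)) := by rw [← C_mul, hsq]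
    have h4 : (C (2 * β * (((n + 1 : ℕ) : ℝ) + 1)) : ℝ[X]) = C (2 * β) + C (2 * β * (n + 1)) := by
      rw [← C_add]; congr 1; push_cast; ring
    rw [h4]
    linear_combination (C (√(2 * β * ((n : ℝ) + 1))) : ℝ[X]) * h2 + hermitePoly β (n + 1) * h3

/-- Integration by parts: `2βx - d/dx` is the adjoint of `d/dx` for the weight `exp(-βx²)`.
Orthonormality follows by lowering both indices together. -/
theorem gaussInt_hermitePoly_succ_mul {β : ℝ} (hβ : 0 < β) (n : ℕ) (q : ℝ[X]) :
    √(2 * β * (n + 1)) * gaussInt β (hermitePoly β (n + 1) * q) =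
      gaussInt β (hermitePoly β n * derivative q) := by
  rw [← gaussInt_C_mul, ← mul_assoc, ← hermitePoly_raise hβ]
  have h1 := gaussInt_derivative hβ (hermitePoly β n * q)
  have h2 : (C (2 * β) * X * hermitePoly β n - derivative (hermitePoly β n)) * q =
      hermitePoly β n * derivative q + C (-1) *
        (derivative (hermitePoly β n * q) - C (2 * β) * X * (hermitePoly β n * q)) := by
    rw [derivative_mul, C_neg, C_1]; ring
  rw [h2, gaussInt_add hβ, gaussInt_C_mul, h1, mul_zero, add_zero]

theorem gaussInt_hermitePoly_mul {β : ℝ} (hβ : 0 < β) (m n : ℕ) :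
    gaussInt β (hermitePoly β m * hermitePoly β n) = if m = n then 1 else 0 := by
  have hr : ∀ n : ℕ, √(2 * β * ((n : ℝ) + 1)) ≠ 0 := fun n => by positivity
  have hzero : ∀ n : ℕ, gaussInt β (hermitePoly β (n + 1) * hermitePoly β 0) = 0 := fun n => by
    have h1 := gaussInt_hermitePoly_succ_mul hβ n (hermitePoly β 0)
    rw [derivative_hermitePoly_zero, mul_zero] at h1
    have h2 : gaussInt β 0 = 0 := by simp [gaussInt]
    rw [h2] at h1
    exact (mul_eq_zero.mp h1).resolve_left (hr n)
  induction m generalizing n with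
  | zero =>
    cases n with
    | zero =>
      have h1 : hermitePoly β 0 * hermitePoly β 0 =
          C (1 / √(gaussInt β 1) * (1 / √(gaussInt β 1))) * 1 := by
        rw [hermitePoly, ← C_mul, mul_one]
      have h2 := gaussInt_one_pos hβ
      rw [h1, gaussInt_C_mul, one_div_mul_one_div, Real.mul_self_sqrt h2.le]
      simp [h2.ne']
    | succ n => rw [mul_comm, hzero]; simp
  | succ m ih =>
    cases n with
    | zero => rw [hzero]; simp
    | succ n =>
      have h1 := gaussInt_hermitePoly_succ_mul hβ m (hermitePoly β (n + 1))
      rw [derivative_hermitePoly_succ hβ, mul_left_comm, gaussInt_C_mul, ih] at h1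
      refine mul_left_cancel₀ (hr m) (h1.trans ?_)
      by_cases h : m = n
      · simp [h]
      · simp [h]

theorem orthonormal_gaussLp_hermitePoly {β : ℝ} (hβ : 0 < β) :
    Orthonormal ℂ fun n => gaussLp hβ (hermitePoly β n) := by
  rw [orthonormal_iff_ite]
  intro m n
  rw [inner_gaussLp, gaussInt_hermitePoly_mul hβ]
  split_ifs <;> simp

end Hermite

/-! ### Completeness of the Hermite functions. -/

section Completeness

open Polynomial
open scoped ContDiff ComplexConjugate FourierTransform SchwartzMap

/-- An integrable function with vanishing Fourier transform vanishes almost everywhere. -/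
theorem ae_eq_zero_of_fourier_eq_zero {F : ℝ → ℂ} (hF : Integrable F) (h0 : ∀ ξ, 𝓕 F ξ = 0) :
    ∀ᵐ x, F x = 0 := by
  refine ae_eq_zero_of_integral_contDiff_smul_eq_zero hF.locallyIntegrable fun ψ h1 h2 => ?_
  have c1 : ContDiff ℝ ∞ fun x => (ψ x : ℂ) := Complex.ofRealCLM.contDiff.comp h1
  have c2 : HasCompactSupport fun x => (ψ x : ℂ) := h2.comp_left Complex.ofReal_zero
  let Ψ : 𝓢(ℝ, ℂ) := c2.toSchwartzMap c1
  -- A test function is the Fourier transform of a Schwartz function, and the transform can be moved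
  -- from `Φ` to `F`.
  let Φ : 𝓢(ℝ, ℂ) := 𝓕⁻ Ψ
  have h3 := VectorFourier.integral_fourierIntegral_smul_eq_flip (L := innerₗ ℝ)
    Real.continuous_fourierChar continuous_inner hF (Φ.integrable (μ := volume))
  rw [flip_innerₗ] at h3
  change ∫ ξ, 𝓕 F ξ • Φ ξ = ∫ x, F x • 𝓕 (Φ : ℝ → ℂ) x at h3
  have h4 : ∀ x, 𝓕 (Φ : ℝ → ℂ) x = ψ x := fun x => by
    have h5 : 𝓕 Φ = Ψ := FourierTransform.fourier_fourierInv_eq Ψ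
    rw [← SchwartzMap.fourier_coe, h5]
    rfl
  simp only [h0, zero_smul, integral_zero, h4] at h3
  rw [h3]
  refine integral_congr_ae (ae_of_all _ fun x => ?_)
  change ψ x • F x = F x • (ψ x : ℂ)
  rw [Complex.real_smul, smul_eq_mul, mul_comm]

/-- Completing the square: half of the Gaussian exponent absorbs `r|x|`. This provides the
integrable majorant for the exponential series. -/
theorem gaussFun_one_mul_exp_le {β : ℝ} (hβ : 0 < β) (r x : ℝ) :
    gaussFun β 1 x * Real.exp (r * |x|) ≤ Real.exp (r ^ 2 / β) * gaussFun (β / 2) 1 x := by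
  simp only [gaussFun, eval_one, one_mul]
  rw [← Real.exp_add, ← Real.exp_add]
  refine Real.exp_le_exp.mpr ?_
  have h1 : 0 ≤ (β * |x| / 2 - r) ^ 2 / β := by positivity
  have h2 : (β * |x| / 2 - r) ^ 2 / β = β * x ^ 2 / 4 - r * |x| + r ^ 2 / β := by
    rw [← sq_abs x]
    field_simp
    ring
  rw [h2] at h1
  linarith

theorem integrable_norm_mul_gaussFun_mul_exp {β : ℝ} (hβ : 0 < β) (f : L2R) (r : ℝ) :
    Integrable fun x : ℝ => ‖f x‖ * (gaussFun β 1 x * Real.exp (r * |x|)) := by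
  have h1 : MemLp (fun x => Real.exp (r ^ 2 / β) * gaussFun (β / 2) 1 x) 2 volume :=
    (memLp_gaussFun (half_pos hβ) 1).const_mul _
  have h2 := (Lp.memLp f).norm.integrable_mul h1
  refine h2.mono' ?_ (ae_of_all _ fun x => ?_)
  · refine (Lp.aestronglyMeasurable f).norm.mul (Continuous.aestronglyMeasurable ?_)
    exact (continuous_gaussFun β 1).mul (by fun_prop)
  · have h3 : 0 ≤ gaussFun β 1 x := by
      simp only [gaussFun, eval_one, one_mul]
      positivity
    rw [Real.norm_of_nonneg (by positivity)]
    exact mul_le_mul_of_nonneg_left (gaussFun_one_mul_exp_le hβ r x) (norm_nonneg _)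

/-- The functions `xᵏ exp(-βx²/2)` are total in `L²(ℝ)`. -/
theorem eq_zero_of_inner_gaussLp_X_pow {β : ℝ} (hβ : 0 < β) {f : L2R}
    (hf : ∀ k : ℕ, ⟪f, gaussLp hβ (X ^ k)⟫_ℂ = 0) : f = 0 := by
  set F : ℝ → ℂ := fun x => conj (f x) * (gaussFun β 1 x : ℂ) with hFdef
  have hg0 : ∀ x, 0 ≤ gaussFun β 1 x := fun x => by
    simp only [gaussFun, eval_one, one_mul]
    positivity
  have hFn : ∀ x, ‖F x‖ = ‖f x‖ * gaussFun β 1 x := fun x => by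
    rw [hFdef, norm_mul, RCLike.norm_conj, Complex.norm_real, Real.norm_of_nonneg (hg0 x)]
  have hFm : AEStronglyMeasurable F volume :=
    (Complex.continuous_conj.comp_aestronglyMeasurable (Lp.aestronglyMeasurable f)).mul
      (Complex.continuous_ofReal.comp (continuous_gaussFun β 1)).aestronglyMeasurable
  have hFi : Integrable F := by
    refine (integrable_norm_mul_gaussFun_mul_exp hβ f 0).mono' hFm (ae_of_all _ fun x => ?_)
    rw [hFn, zero_mul, Real.exp_zero, mul_one]
  have hmom : ∀ k : ℕ, ∫ x, F x * (x : ℂ) ^ k = 0 := fun k => by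
    rw [← hf k, integral_mul_congr (EventuallyEq.refl _ _) (coeFn_gaussLp hβ (X ^ k))]
    refine integral_congr_ae (ae_of_all _ fun x => ?_)
    simp only [hFdef, gaussFun, eval_one, one_mul, eval_pow, eval_X]
    push_cast
    ring
  -- Expanding the exponential and integrating termwise reduces this to the moments; `z = -2πiξ`
  -- then gives the Fourier transform of `F`.
  have hexp : ∀ z : ℂ, ∫ x : ℝ, F x * Complex.exp (z * x) = 0 := by
    intro z
    have hsum := hasSum_integral_of_dominated_convergence (μ := (volume : Measure ℝ))
      (F := fun (k : ℕ) (x : ℝ) => F x * ((z * x) ^ k / (k.factorial : ℂ)))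
      (f := fun x : ℝ => F x * Complex.exp (z * x))
      (fun k x => ‖F x‖ * ((‖z‖ * |x|) ^ k / (k.factorial : ℝ))) (fun k => ?_)
      (fun k => ae_of_all _ fun x => ?_) (ae_of_all _ fun x => ?_) ?_ (ae_of_all _ fun x => ?_)
    · have h1 : ∀ k : ℕ, ∫ x : ℝ, F x * ((z * x) ^ k / (k.factorial : ℂ)) = 0 := fun k => by
        have h2 : ∀ x : ℝ, F x * ((z * x) ^ k / (k.factorial : ℂ)) =
            (z ^ k / (k.factorial : ℂ)) * (F x * (x : ℂ) ^ k) := fun x => by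
          rw [mul_pow]; ring
        simp only [h2]
        rw [integral_const_mul, hmom, mul_zero]
      simp only [h1] at hsum
      exact (hasSum_zero.unique hsum).symm
    · exact hFm.mul (Continuous.aestronglyMeasurable (by fun_prop))
    · rw [norm_mul, norm_div, norm_pow, norm_mul z, Complex.norm_real, Complex.norm_natCast,
        Real.norm_eq_abs]
    · exact (Real.summable_pow_div_factorial _).mul_left _
    · refine (integrable_norm_mul_gaussFun_mul_exp hβ f ‖z‖).congr (ae_of_all _ fun x => ?_)
      change ‖f x‖ * (gaussFun β 1 x * Real.exp (‖z‖ * |x|)) =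
        ∑' k : ℕ, ‖F x‖ * ((‖z‖ * |x|) ^ k / (k.factorial : ℝ))
      rw [tsum_mul_left, hFn, mul_assoc, Real.exp_eq_exp_ℝ, NormedSpace.exp_eq_tsum_div]
    · rw [Complex.exp_eq_exp_ℂ]
      exact (NormedSpace.expSeries_div_hasSum_exp (𝔸 := ℂ) (z * x)).mul_left _
  have hF0 := ae_eq_zero_of_fourier_eq_zero hFi fun ξ => by
    rw [Real.fourier_real_eq_integral_exp_smul]
    rw [← hexp (-2 * Real.pi * ξ * Complex.I)]
    refine integral_congr_ae (ae_of_all _ fun x => ?_)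
    simp only [smul_eq_mul]
    rw [mul_comm]
    congr 2
    push_cast
    ring
  refine Lp.ext ?_
  filter_upwards [hF0, Lp.coeFn_zero ℂ 2 (volume : Measure ℝ)] with x hx h0
  rw [h0, Pi.zero_apply]
  have h1 : gaussFun β 1 x ≠ 0 := by
    simp only [gaussFun, eval_one, one_mul]
    exact (Real.exp_pos _).ne'
  have h2 := (mul_eq_zero.mp hx).resolve_right (Complex.ofReal_ne_zero.mpr h1)
  simpa using h2

/-- The Hermite functions for the weight `exp(-βx²)`, as a Hilbert basis of `L²(ℝ)`. -/
theorem exists_hermiteBasis {β : ℝ} (hβ : 0 < β) :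
    ∃ h : HilbertBasis ℕ ℂ L2R, ∀ n, h n = gaussLp hβ (hermitePoly β n) := by
  refine ⟨HilbertBasis.mkOfOrthogonalEqBot (orthonormal_gaussLp_hermitePoly hβ) ?_, fun n => by
    rw [HilbertBasis.coe_mkOfOrthogonalEqBot]⟩
  rw [Submodule.eq_bot_iff]
  intro f hf
  have h0 : ∀ n, ⟪f, gaussLp hβ (hermitePoly β n)⟫_ℂ = 0 := fun n =>
    (Submodule.mem_orthogonal' _ _).mp hf _ (Submodule.subset_span ⟨n, rfl⟩)
  have hlin : ∀ (c : ℝ) (p : ℝ[X]), ⟪f, gaussLp hβ p⟫_ℂ = 0 → ⟪f, gaussLp hβ (C c * p)⟫_ℂ = 0 :=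
    fun c p hp => by rw [gaussLp_C_mul, inner_smul_right, hp, mul_zero]
  have hadd : ∀ p q : ℝ[X], ⟪f, gaussLp hβ p⟫_ℂ = 0 → ⟪f, gaussLp hβ q⟫_ℂ = 0 →
      ⟪f, gaussLp hβ (p + q)⟫_ℂ = 0 :=
    fun p q hp hq => by rw [gaussLp_add, inner_add_right, hp, hq, add_zero]
  -- Induction on `k` through `2βx h_n = √(2β(n+1)) h_{n+1} + h_n'`, where `h_n'` is a multiple of
  -- `h_{n-1}`, or zero for `n = 0`.
  have hmul : ∀ k n : ℕ, ⟪f, gaussLp hβ (X ^ k * hermitePoly β n)⟫_ℂ = 0 := by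
    intro k
    induction k with
    | zero => intro n; rw [pow_zero, one_mul]; exact h0 n
    | succ k ih =>
      intro n
      have hd : ⟪f, gaussLp hβ (X ^ k * derivative (hermitePoly β n))⟫_ℂ = 0 := by
        cases n with
        | zero => rw [derivative_hermitePoly_zero, mul_zero, gaussLp_zero, inner_zero_right]
        | succ n =>
          rw [derivative_hermitePoly_succ hβ, mul_left_comm]
          exact hlin _ _ (ih n)
      have h1 : X ^ (k + 1) * hermitePoly β n = C (1 / (2 * β)) *
          (C (√(2 * β * (n + 1))) * (X ^ k * hermitePoly β (n + 1)) +
            X ^ k * derivative (hermitePoly β n)) := by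
        have h2 : (C (1 / (2 * β)) * C (2 * β) : ℝ[X]) = 1 := by
          rw [← C_mul, one_div_mul_cancel (by positivity), C_1]
        have h3 := hermitePoly_raise hβ n
        linear_combination -(X ^ (k + 1) * hermitePoly β n) * h2 + C (1 / (2 * β)) * X ^ k * h3
      rw [h1]
      exact hlin _ _ (hadd _ _ (hlin _ _ (ih (n + 1))) hd)
  refine eq_zero_of_inner_gaussLp_X_pow hβ fun k => ?_
  have h1 : (X ^ k : ℝ[X]) = C (√(gaussInt β 1)) * (X ^ k * hermitePoly β 0) := by
    have h2 : √(gaussInt β 1) ≠ 0 := (Real.sqrt_pos.mpr (gaussInt_one_pos hβ)).ne'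
    rw [hermitePoly, mul_left_comm, ← C_mul, mul_one_div_cancel h2, C_1, mul_one]
  rw [h1]
  exact hlin _ _ (hmul k 0)

end Completeness

/-! ### Position and momentum as an oscillator, and their commutator. -/

section PositionMomentum

open Polynomial

theorem apply_eq_of_mem_graph {H : Type*} [NormedAddCommGroup H] [InnerProductSpace ℂ H]
    {A : H →ₗ.[ℂ] H} {x y : H} (h : (x, y) ∈ A.graph) (hx : x ∈ A.domain) : A ⟨x, hx⟩ = y := by
  obtain ⟨z, hz1, hz2⟩ := (LinearPMap.mem_graph_iff _).mp h
  obtain rfl : z = ⟨x, hx⟩ := Subtype.ext hz1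
  exact hz2

theorem isFormalAdjoint_smul {H : Type*} [NormedAddCommGroup H] [InnerProductSpace ℂ H]
    {A : H →ₗ.[ℂ] H} (hA : A.IsFormalAdjoint A) (s : ℝ) :
    ((s : ℂ) • A).IsFormalAdjoint ((s : ℂ) • A) := by
  intro x y
  change ⟪(s : ℂ) • A ⟨x, x.2⟩, y⟫_ℂ = ⟪(x : H), (s : ℂ) • A ⟨y, y.2⟩⟫_ℂ
  rw [inner_smul_left, inner_smul_right, Complex.conj_ofReal]
  congr 1
  exact hA ⟨x, x.2⟩ ⟨y, y.2⟩

variable {β : ℝ} (hβ : 0 < β)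

theorem gaussLp_mem_graph_position (p : ℝ[X]) :
    (gaussLp hβ p, gaussLp hβ (X * p)) ∈ position.graph :=
  position_graph ▸ gaussLp_mem_positionGraph hβ p

theorem gaussLp_mem_graph_momentum (p : ℝ[X]) :
    (gaussLp hβ p, -Complex.I • gaussLp hβ (derivative p - C β * X * p)) ∈ momentum.graph :=
  momentum_graph ▸ gaussLp_mem_momentumGraph hβ p

theorem gaussLp_raise {s t : ℝ} (ht : 0 < t) (hst : β = s / t) (p : ℝ[X]) :
    (s : ℂ) • gaussLp hβ (X * p) - Complex.I • (t : ℂ) • (-Complex.I •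
      gaussLp hβ (derivative p - C β * X * p)) =
      (t : ℂ) • gaussLp hβ (C (2 * β) * X * p - derivative p) := by
  have h1 : C (2 * β) * X * p - derivative p =
      C β * (X * p) + C (-1) * (derivative p - C β * X * p) := by
    rw [C_neg, C_1, C_mul, show (C 2 : ℝ[X]) = 2 from rfl]; ring
  have h2 : (s : ℂ) = t * β := by
    rw [hst, ← Complex.ofReal_mul, mul_div_cancel₀ _ ht.ne']
  rw [h1, gaussLp_add, gaussLp_C_mul, gaussLp_C_mul, h2]
  set a := gaussLp hβ (X * p)
  set b := gaussLp hβ (derivative p - C β * X * p)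
  have h3 : Complex.I • (t : ℂ) • -Complex.I • b = (t : ℂ) • b := by
    rw [smul_smul, smul_smul]
    congr 1
    linear_combination -(t : ℂ) * Complex.I_mul_I
  rw [h3]
  push_cast
  module

/-- With `β = s/t` the Gaussian is annihilated by `s x + t d/dx`, so this operator acts on the
polynomial factor alone, as `t d/dx`. -/
theorem gaussLp_lower {s t : ℝ} (ht : 0 < t) (hst : β = s / t) (p : ℝ[X]) :
    (s : ℂ) • gaussLp hβ (X * p) + Complex.I • (t : ℂ) • (-Complex.I •
      gaussLp hβ (derivative p - C β * X * p)) = (t : ℂ) • gaussLp hβ (derivative p) := by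
  have h1 : derivative p = C β * (X * p) + (derivative p - C β * X * p) := by ring
  have h2 : (s : ℂ) = t * β := by
    rw [hst, ← Complex.ofReal_mul, mul_div_cancel₀ _ ht.ne']
  nth_rw 2 [h1]
  rw [gaussLp_add, gaussLp_C_mul, h2]
  set a := gaussLp hβ (X * p)
  set b := gaussLp hβ (derivative p - C β * X * p)
  have h3 : Complex.I • (t : ℂ) • -Complex.I • b = (t : ℂ) • b := by
    rw [smul_smul, smul_smul]
    congr 1
    linear_combination -(t : ℂ) * Complex.I_mul_I
  rw [h3]
  module

/-- Converts the Hermite weights for `β = s/t` into ladder weights with `ε = 2st`. -/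
theorem mul_sqrt_ratio {s t : ℝ} (ht : 0 < t) (n : ℕ) :
    t * √(2 * (s / t) * (n + 1)) = √(2 * s * t * (n + 1)) := by
  have h1 : 2 * s * t * ((n : ℝ) + 1) = t ^ 2 * (2 * (s / t) * (n + 1)) := by
    field_simp
  rw [h1, Real.sqrt_mul (sq_nonneg t), Real.sqrt_sq ht.le]

/-- The rescaled position and momentum operators form a harmonic oscillator. -/
theorem isOscillator_position_momentum {s t : ℝ} (ht : 0 < t) (hst : β = s / t)
    {h : HilbertBasis ℕ ℂ L2R} (hh : ∀ n, h n = gaussLp hβ (hermitePoly β n)) :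
    IsOscillator ((s : ℂ) • position) ((t : ℂ) • momentum) h (2 * s * t) := by
  have hA : ∀ n, h n ∈ position.domain := fun n =>
    hh n ▸ LinearPMap.mem_domain_of_mem_graph (gaussLp_mem_graph_position hβ (hermitePoly β n))
  have hB : ∀ n, h n ∈ momentum.domain := fun n =>
    hh n ▸ LinearPMap.mem_domain_of_mem_graph (gaussLp_mem_graph_momentum hβ (hermitePoly β n))
  have vA : ∀ n, position ⟨h n, hA n⟩ = gaussLp hβ (X * hermitePoly β n) := fun n =>
    apply_eq_of_mem_graph (hh n ▸ gaussLp_mem_graph_position hβ _) _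
  have vB : ∀ n, momentum ⟨h n, hB n⟩ = -Complex.I • gaussLp hβ
      (derivative (hermitePoly β n) - C β * X * hermitePoly β n) := fun n =>
    apply_eq_of_mem_graph (hh n ▸ gaussLp_mem_graph_momentum hβ _) _
  refine ⟨isFormalAdjoint_smul position_isFormalAdjoint s,
    isFormalAdjoint_smul momentum_isFormalAdjoint t, hA, hB, fun n => ?_, ?_, fun n => ?_⟩
  · change (s : ℂ) • position ⟨h n, hA n⟩ - Complex.I • (t : ℂ) • momentum ⟨h n, hB n⟩ = _
    rw [vA, vB, gaussLp_raise hβ ht hst, hermitePoly_raise hβ, gaussLp_C_mul, ← hh, smul_smul,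
      ← Complex.ofReal_mul, hst, mul_sqrt_ratio ht]
  · change (s : ℂ) • position ⟨h 0, hA 0⟩ + Complex.I • (t : ℂ) • momentum ⟨h 0, hB 0⟩ = _
    rw [vA, vB, gaussLp_lower hβ ht hst, derivative_hermitePoly_zero, gaussLp_zero, smul_zero]
  · change (s : ℂ) • position ⟨h (n + 1), hA (n + 1)⟩ +
      Complex.I • (t : ℂ) • momentum ⟨h (n + 1), hB (n + 1)⟩ = _
    rw [vA, vB, gaussLp_lower hβ ht hst, derivative_hermitePoly_succ hβ, gaussLp_C_mul, ← hh,
      smul_smul, ← Complex.ofReal_mul, hst, mul_sqrt_ratio ht]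

/-- The canonical commutation relation on polynomials times a Gaussian. -/
theorem commutator_gaussLp {s t : ℝ} (p : ℝ[X]) :
    ∃ hp : gaussLp hβ p ∈ (commutator ((s : ℂ) • position) ((t : ℂ) • momentum)).domain,
      commutator ((s : ℂ) • position) ((t : ℂ) • momentum) ⟨gaussLp hβ p, hp⟩ =
        ((s * t : ℝ) : ℂ) • Complex.I • gaussLp hβ p := by
  set q := derivative p - C β * X * p with hq
  have gA := gaussLp_mem_graph_position hβ p
  have gB := gaussLp_mem_graph_momentum hβ p
  rw [← hq] at gB
  have gAB := position.graph.smul_mem ((t : ℂ) * -Complex.I) (gaussLp_mem_graph_position hβ q)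
  have gBA := momentum.graph.smul_mem (s : ℂ) (gaussLp_mem_graph_momentum hβ (X * p))
  rw [Prod.smul_mk] at gAB gBA
  have hA := LinearPMap.mem_domain_of_mem_graph gA
  have hB := LinearPMap.mem_domain_of_mem_graph gB
  have vA := apply_eq_of_mem_graph gA hA
  have vB := apply_eq_of_mem_graph gB hB
  have vB' : (t : ℂ) • momentum ⟨gaussLp hβ p, hB⟩ = ((t : ℂ) * -Complex.I) • gaussLp hβ q := by
    rw [vB, smul_smul]
  have vA' : (s : ℂ) • position ⟨gaussLp hβ p, hA⟩ = (s : ℂ) • gaussLp hβ (X * p) := by rw [vA]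
  rw [← vB'] at gAB
  rw [← vA'] at gBA
  have hAB := LinearPMap.mem_domain_of_mem_graph gAB
  have hBA := LinearPMap.mem_domain_of_mem_graph gBA
  refine ⟨⟨⟨hB, hAB⟩, hA, hBA⟩, ?_⟩
  change (s : ℂ) • position ⟨(t : ℂ) • momentum ⟨gaussLp hβ p, hB⟩, hAB⟩ -
    (t : ℂ) • momentum ⟨(s : ℂ) • position ⟨gaussLp hβ p, hA⟩, hBA⟩ = _
  rw [apply_eq_of_mem_graph gAB hAB, apply_eq_of_mem_graph gBA hBA]
  have h1 : derivative (X * p) - C β * X * (X * p) = p + X * q := by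
    rw [hq, derivative_mul, derivative_X]; ring
  rw [h1, gaussLp_add]
  push_cast
  module

/-- On the Gaussian, a unit vector, the commutator acts as multiplication by `i s t`. -/
theorem le_of_commutatorBound {s t δ : ℝ} (hs : 0 < s) (ht : 0 < t)
    (h : CommutatorBound ((s : ℂ) • position) ((t : ℂ) • momentum) δ) : s * t ≤ δ := by
  obtain ⟨hp, he⟩ := commutator_gaussLp (s := s) (t := t) one_pos (hermitePoly 1 0)
  have h1 := h ⟨_, hp⟩
  have h2 : ‖gaussLp one_pos (hermitePoly 1 0)‖ = 1 :=
    (orthonormal_gaussLp_hermitePoly one_pos).1 0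
  rw [he, norm_smul, norm_smul, Complex.norm_I, h2, Complex.norm_real,
    Real.norm_of_nonneg (by positivity), one_mul, mul_one, mul_one] at h1
  exact h1

theorem commutatorBound_position_momentum : CommutatorBound position momentum 1 := by
  obtain ⟨h, hh⟩ := exists_hermiteBasis one_pos
  rintro ⟨x, ⟨hB, hAB⟩, hA, hBA⟩
  -- For general `x` in the natural domain, both products are moved by symmetry onto Hermite
  -- functions, where the commutator is known; completeness then gives `i x`.
  have key : commutator position momentum ⟨x, ⟨hB, hAB⟩, hA, hBA⟩ = Complex.I • x := by
    refine hilbertBasis_ext h fun n => ?_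
    have hcomm := commutator_gaussLp (s := 1) (t := 1) one_pos (hermitePoly 1 n)
    rw [mul_one, Complex.ofReal_one, one_smul, one_smul] at hcomm
    simp only [one_smul] at hcomm
    obtain ⟨⟨⟨hB', hAB'⟩, hA', hBA'⟩, he⟩ := hcomm
    change position ⟨momentum ⟨_, hB'⟩, hAB'⟩ - momentum ⟨position ⟨_, hA'⟩, hBA'⟩ = _ at he
    change ⟪h n, position ⟨momentum ⟨x, hB⟩, hAB⟩ - momentum ⟨position ⟨x, hA⟩, hBA⟩⟫_ℂ = _
    have e1 := position_isFormalAdjoint ⟨_, hA'⟩ ⟨momentum ⟨x, hB⟩, hAB⟩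
    have e2 := momentum_isFormalAdjoint ⟨position ⟨_, hA'⟩, hBA'⟩ ⟨x, hB⟩
    have e3 := momentum_isFormalAdjoint ⟨_, hB'⟩ ⟨position ⟨x, hA⟩, hBA⟩
    have e4 := position_isFormalAdjoint ⟨momentum ⟨_, hB'⟩, hAB'⟩ ⟨x, hA⟩
    have e5 := congrArg (fun y => ⟪y, x⟫_ℂ) he
    simp only [inner_sub_left, inner_smul_left, Complex.conj_I] at e5
    rw [hh n, inner_sub_right, inner_smul_right, ← e1, ← e2, ← e3, ← e4]
    linear_combination -e5
  rw [key, norm_smul, Complex.norm_I]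

theorem admissible_position_momentum : Admissible position momentum := by
  obtain ⟨h, hh⟩ := exists_hermiteBasis one_pos
  have hosc := isOscillator_position_momentum one_pos (s := 1) (t := 1) one_pos (by norm_num) hh
  rw [Complex.ofReal_one, one_smul, one_smul] at hosc
  have hd := hosc.dense_domain
  refine ⟨position_isSelfAdjoint (hd.mono fun x hx => hx.1),
    momentum_isSelfAdjoint (hd.mono fun x hx => hx.2), hd, ?_,
    ⟨1, commutatorBound_position_momentum⟩, hosc.exists_compact_inverse (by norm_num)⟩
  have h1 := h.dense_span
  rw [← Submodule.dense_iff_topologicalClosure_eq_top] at h1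
  refine h1.mono (Submodule.span_le.mpr ?_)
  rintro _ ⟨n, rfl⟩
  obtain ⟨hp, -⟩ := commutator_gaussLp (s := 1) (t := 1) one_pos (hermitePoly 1 n)
  rw [Complex.ofReal_one, one_smul, one_smul, ← hh n] at hp
  exact hp

end PositionMomentum

end Bott
end

theorem mainTheorem3 : Bott.IsOmega Bott.position Bott.momentum 1 := by
  obtain ⟨h₁, -⟩ := Bott.exists_hermiteBasis one_pos
  -- The choice `δ = 1/100` makes `ε = 2st ≤ 1/50`, the bound required by `isOmegaSmall`.
  refine ⟨Bott.admissible_position_momentum, ⟨h₁⟩, 1 / 100, by norm_num, fun s t hs ht hc => ?_⟩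
  have hst := Bott.le_of_commutatorBound hs ht hc
  -- The Hermite basis depends on the rescaling, through `β = s/t`.
  obtain ⟨h, hh⟩ := Bott.exists_hermiteBasis (div_pos hs ht)
  exact (Bott.isOscillator_position_momentum (div_pos hs ht) ht rfl hh).isOmegaSmall (by positivity)
    (by linarith)
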